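/- All graphs are finite and simple. A graph property $\mathcal P$ is monotone if it is preserved under isomorphism and under deletion of edges and vertices (it passes to all subgraphs). For such $\mathcal P$ let $n_{\mathcal P}(k)$ be the smallest number of vertices of a graph in $\mathcal P$ with chromatic number exactly $k$ ($n_{\mathcal P}(k)=\infty$ if there is none). For $\alpha\ge 1$, a function $f:[3,\infty)\to(0,\infty)$ is $\alpha$-bounded if it is non-decreasing and $y^{\alpha}f(x)\ge x^{\alpha}f(y)$ whenever $y\ge x\ge 3$. **Theorem.** For all $\varepsilon>0$, $\alpha,m\ge 1$ and $M>0$ there exists $k_1=k_1(\varepsilon,\alpha,m,M)$ such that the following holds. Let $f$ be an $\alpha$-bounded function with $f(3)\le M$, and let $\mathcal P$ be a monotone graph property with $n_{\mathcal P}(k)\ge f(k)$ for all integers $k\ge\max\{m,3\}$. Then for every integer $k\ge k_1$, every $k$-chromatic graph $G\in\mathcal P$ contains (i) a cycle of length at least $(1-\varepsilon)f(k)$, and (ii) cycles of at least $(1-\varepsilon)f(k/4)$ consecutive lengths, i.e. there are integers $a\ge 0$ and $t\ge(1-\varepsilon)f(k/4)$ such that $G$ contains a cycle of each of the lengths $a,a+1,\dots,a+t-1$.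 -/

import Mathlib

open scoped ENNReal

universe u

/-- A property of graphs: a predicate on all simple graphs (with vertex type in `Type u`). Only its
values on finite graphs are ever used. -/
abbrev GraphProperty : Type (u + 1) := ∀ V : Type u, SimpleGraph V → Prop

/-- A property of finite graphs is monotone if it passes from a graph to all its subgraphs.
`H.IsContained G` says that `H` is isomorphic to a (not necessarily induced) subgraph of `G`,
so invariance under isomorphism is included. -/
def GraphProperty.IsMonotone (P : GraphProperty.{u}) : Prop :=
  ∀ (V W : Type u) [Finite V] [Finite W] (G : SimpleGraph V) (H : SimpleGraph W),
    H.IsContained G → P V G → P W H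

/-- The smallest order of a finite `k`-chromatic graph with property `P`
(equal to `⊤` if there is no such graph). -/
noncomputable def GraphProperty.minOrder (P : GraphProperty.{u}) (k : ℕ) : ℕ∞ :=
  sInf {n : ℕ∞ | ∃ (V : Type u) (_ : Finite V) (G : SimpleGraph V),
    P V G ∧ G.chromaticNumber = k ∧ n = ENat.card V}

/-- `f : [3, ∞) → (0, ∞)` is `α`-bounded: it is positive and non-decreasing and
`y ^ α * f x ≥ x ^ α * f y` for `y ≥ x ≥ 3`. Values of `f` outside `[3, ∞)` play no role. -/
structure IsAlphaBounded (α : ℝ) (f : ℝ → ℝ) : Prop where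
  pos : ∀ x, 3 ≤ x → 0 < f x
  mono : MonotoneOn f (Set.Ici 3)
  growth : ∀ x y, 3 ≤ x → x ≤ y → x ^ α * f y ≤ y ^ α * f x

/-- The graph `G` contains a cycle of length `n`. -/
def HasCycleOfLength {V : Type u} (G : SimpleGraph V) (n : ℕ) : Prop :=
  ∃ (v : V) (p : G.Walk v v), p.IsCycle ∧ p.length = n

/-! The property enters only through one inequality: every vertex set `S` with chromatic number `q ≥
max(m, 3)` has at least `f q` vertices, because the induced subgraph is again in the class. The rest
is about one graph.

Long cycles. `exists_unseparable_subset` gives a part `A`, at a cost of at most `2t` in chromatic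
number, that no separation of order at most `t` splits into two sides of more than `2t` vertices.
Let `C` be a longest cycle in `A` and `H = A \ C`. By Menger's theorem a fairly long cycle in `H` is
joined to `C` by `t + 1` disjoint paths, two of which attach close together on `C`; rerouting would
lengthen `C`. So the cycles of `H` are shorter than `C` by a factor of order `t`
(`exists_dominant_cycle`). If `C` had fewer than `(1 - ε) f k` vertices, its chromatic number would
be at most `δ k` with `δ < 1`, so `H` would keep a constant fraction of `k`. But `H` then has a
cycle of length at least a constant times `f k` (`exists_linear_cycle`, the same dichotomy run as an
induction), which is a contradiction once `t` is large.

Consecutive lengths. Some breadth-first level carries half of the chromatic number. A connected part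
of it is split, by branches of the search tree, into `A` and the rest, so that every path across the
split closes up through the tree with the same extra length. A cycle of length `c` in `A` supplies
paths across of `c` consecutive lengths. The larger half carries a quarter of the chromatic number,
whence `f (k / 4)`. -/

namespace SimpleGraph

/-! ### Menger's theorem for vertex sets -/

variable {V : Type u}

/-- `Z` meets every walk of `G` from `X` to `Y`. -/
def Separates (G : SimpleGraph V) (X Y Z : Set V) : Prop :=
  ∀ a ∈ X, ∀ b ∈ Y, ∀ p : G.Walk a b, ∃ z ∈ p.support, z ∈ Z

/-- There are `n` pairwise disjoint paths of `G` from `X` to `Y`. -/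
def IsLinked (G : SimpleGraph V) (X Y : Set V) (n : ℕ) : Prop :=
  ∃ (a b : Fin n → V) (p : ∀ i, G.Walk (a i) (b i)),
    (∀ i, a i ∈ X) ∧ (∀ i, b i ∈ Y) ∧ (∀ i, (p i).IsPath) ∧
      ∀ i j v, v ∈ (p i).support → v ∈ (p j).support → i = j

/-- Stop the walk at its first vertex in `Z ∪ {x}`. Until then it stays in `U`, where every edge not
starting at `x` survives in `G'`. -/
theorem exists_walk_to_boundary {G G' : SimpleGraph V} {U Z : Set V} {x : V}
    (hU : ∀ u ∈ U, ∀ v, u ≠ x → G.Adj u v → G'.Adj u v ∧ (v ∈ U ∨ v ∈ Z)) {u b : V}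
    (p : G.Walk u b) (hu : u ∈ U ∨ u ∈ Z) (hb : b ∉ U) :
    ∃ z ∈ insert x Z, ∃ q : G'.Walk u z, q.support ⊆ p.support := by
  induction p with
  | nil => exact ⟨_, Or.inr (hu.resolve_left hb), .nil, by simp⟩
  | @cons u v b h p ih =>
    by_cases hux : u = x
    · exact ⟨u, Or.inl hux, .nil, by simp⟩
    by_cases huZ : u ∈ Z
    · exact ⟨u, Or.inr huZ, .nil, by simp⟩
    obtain ⟨h1, h2⟩ := hU u (hu.resolve_right huZ) v hux h
    obtain ⟨z, hz, q, hq⟩ := ih h2 hb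
    refine ⟨z, hz, .cons h1 q, ?_⟩
    rw [Walk.support_cons, Walk.support_cons]
    exact List.cons_subset_cons _ hq

theorem Walk.IsPath.mem_or_mem_of_closed {G : SimpleGraph V} {U Z : Set V}
    (hU : ∀ u ∈ U, ∀ v, G.Adj u v → v ∈ U ∨ v ∈ Z) {u b : V} {p : G.Walk u b} (hp : p.IsPath)
    (hu : u ∈ U ∨ u ∈ Z) (hZ : ∀ v ∈ p.support, v ∈ Z → v = b) :
    ∀ v ∈ p.support, v ∈ U ∨ v ∈ Z := by
  induction p with
  | nil => simpa using hu
  | @cons u v b h p ih =>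
    rw [Walk.cons_isPath_iff] at hp
    have huZ : u ∉ Z := fun huZ => hp.2 (by
      rw [hZ u (by simp) huZ]; exact p.end_mem_support)
    intro w hw
    rw [Walk.support_cons, List.mem_cons] at hw
    rcases hw with rfl | hw
    · exact hu
    · exact ih hp.1 (hU u (hu.resolve_right huZ) v h)
        (fun v hv => hZ v (by simp [hv])) w hw

/-- The `n` disjoint paths have distinct ends, which therefore exhaust the `n`-set `Y`; an interior
visit to `Y` would hit the end of another path. -/
theorem IsLinked.exists_index [Finite V] {G : SimpleGraph V} {Y : Set V} {n : ℕ}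
    {a b : Fin n → V} {p : ∀ i, G.Walk (a i) (b i)} (hb : ∀ i, b i ∈ Y)
    (hd : ∀ i j v, v ∈ (p i).support → v ∈ (p j).support → i = j) (hY : Y.ncard = n) :
    (∀ y ∈ Y, ∃ i, b i = y) ∧ ∀ i, ∀ v ∈ (p i).support, v ∈ Y → v = b i := by
  have hinj : Function.Injective b := fun i j hij =>
    hd i j (b i) (p i).end_mem_support (by rw [hij]; exact (p j).end_mem_support)
  have hr : Set.range b = Y := by
    refine Set.eq_of_subset_of_ncard_le (by rintro _ ⟨i, rfl⟩; exact hb i) ?_ (Set.toFinite _)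
    rw [hY, ← Set.image_univ, Set.ncard_image_of_injective _ hinj]
    simp
  have hs : ∀ y ∈ Y, ∃ i, b i = y := fun y hy => by rw [← hr] at hy; exact hy
  refine ⟨hs, fun i v hv hvY => ?_⟩
  obtain ⟨j, rfl⟩ := hs v hvY
  rw [hd i j _ hv (p j).end_mem_support]

/-- **Menger's theorem**. -/
theorem isLinked_of_forall_separates [Finite V] (n : ℕ) (G : SimpleGraph V) (X Y : Set V)
    (h : ∀ Z, G.Separates X Y Z → n ≤ Z.ncard) : G.IsLinked X Y n := by
  classical
  induction hm : G.edgeSet.ncard using Nat.strong_induction_on generalizing G X Y with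
  | _ m ih =>
  subst hm
  by_cases hG : G = ⊥
  · subst hG
    have h1 : n ≤ (X ∩ Y).ncard := h _ fun a ha b hb p => by
      cases p with
      | nil => exact ⟨a, by simp, ha, hb⟩
      | cons h _ => exact absurd h (by simp)
    have : Fintype ↥(X ∩ Y) := Fintype.ofFinite _
    obtain ⟨e⟩ : Nonempty (Fin n ↪ ↥(X ∩ Y)) :=
      Function.Embedding.nonempty_of_card_le (by
        rw [Fintype.card_fin, ← Nat.card_eq_fintype_card]; simpa using h1)
    refine ⟨fun i => e i, fun i => e i, fun i => .nil, fun i => (e i).2.1, fun i => (e i).2.2,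
      fun i => .nil, fun i j v hi hj => ?_⟩
    simp only [Walk.support_nil, List.mem_singleton] at hi hj
    exact e.injective (Subtype.ext (hi.symm.trans hj))
  obtain ⟨x₀, y₀, hxy₀⟩ : ∃ x y, G.Adj x y := by
    by_contra! hcon
    exact hG (by ext x y; simp [hcon x y])
  set G' := G.deleteEdges {s(x₀, y₀)} with hG'
  have hle : G' ≤ G := deleteEdges_le _
  have hlt : G'.edgeSet.ncard < G.edgeSet.ncard := by
    refine Set.ncard_lt_ncard ⟨edgeSet_mono hle, fun hc => ?_⟩ (Set.toFinite _)
    have := hc (show s(x₀, y₀) ∈ G.edgeSet from hxy₀)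
    simp [hG'] at this
  by_cases hsep : ∀ Z, G'.Separates X Y Z → n ≤ Z.ncard
  · obtain ⟨a, b, p, ha, hb, hp, hd⟩ := ih _ hlt G' X Y hsep rfl
    exact ⟨a, b, fun i => (p i).mapLe hle, ha, hb, fun i => (hp i).mapLe hle,
      fun i j v hi hj => hd i j v (by simpa using hi) (by simpa using hj)⟩
  push Not at hsep
  obtain ⟨Z, hZ, hZn⟩ := hsep
  have hadj : ∀ {u v}, G.Adj u v → ¬ (u = x₀ ∧ v = y₀ ∨ u = y₀ ∧ v = x₀) → G'.Adj u v :=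
    fun huv hne => by
      rw [hG', deleteEdges_adj]
      exact ⟨huv, by simpa using hne⟩
  -- the vertices reachable from `X` off `Z`
  set R : Set V := {v | ∃ a ∈ X, ∃ p : G'.Walk a v, ∀ w ∈ p.support, w ∉ Z} with hR
  have hRZ : ∀ v ∈ R, v ∉ Z := fun v ⟨a, _, p, hp⟩ => hp v p.end_mem_support
  have hXR : ∀ v ∈ X, v ∈ R ∨ v ∈ Z := fun v hv => by
    by_cases hvZ : v ∈ Z
    · exact Or.inr hvZ
    · exact Or.inl ⟨v, hv, .nil, by simpa using hvZ⟩
  have hYR : ∀ v ∈ Y, v ∉ R := fun v hv ⟨a, ha, p, hp⟩ => by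
    obtain ⟨z, hz, hz'⟩ := hZ a ha v hv p
    exact hp z hz hz'
  have hRc : ∀ u ∈ R, ∀ v, G'.Adj u v → v ∈ R ∨ v ∈ Z := by
    rintro u ⟨a, ha, p, hp⟩ v huv
    by_cases hvZ : v ∈ Z
    · exact Or.inr hvZ
    refine Or.inl ⟨a, ha, p.concat huv, fun w hw => ?_⟩
    rw [Walk.support_concat, List.mem_append, List.mem_singleton] at hw
    rcases hw with hw | rfl
    exacts [hp w hw, hvZ]
  -- The case where the deleted edge crosses from `R` to the far side of `Z`. Both `Z ∪ {x}` and `Z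
  -- ∪ {y}` then have exactly `n` elements, and induction links `X` to the first and `Y` to the
  -- second. The two systems are glued along `Z` and along the edge `xy`.
  have key : ∀ x y, G.Adj x y → s(x, y) = s(x₀, y₀) → x ∈ R → y ∉ R → y ∉ Z →
      G.IsLinked X Y n := by
    intro x y hxy hs hxR hyR hyZ
    have hadj' : ∀ {u v}, G.Adj u v → u ≠ x → u ≠ y → G'.Adj u v := fun huv h1 h2 => by
      rw [hG', deleteEdges_adj, ← hs]
      refine ⟨huv, ?_⟩
      simp [h1, h2]
    have hxZ := hRZ x hxR
    set R' : Set V := {v | v ∉ R ∧ v ∉ Z} with hR'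
    have hR'c : ∀ u ∈ R', ∀ v, G'.Adj u v → v ∈ R' ∨ v ∈ Z := by
      intro u hu v huv
      by_cases hvZ : v ∈ Z
      · exact Or.inr hvZ
      refine Or.inl ⟨fun hvR => ?_, hvZ⟩
      rcases hRc v hvR u huv.symm with h1 | h1
      exacts [hu.1 h1, hu.2 h1]
    have hYR' : ∀ v ∈ Y, v ∈ R' ∨ v ∈ Z := fun v hv => by
      by_cases hvZ : v ∈ Z
      · exact Or.inr hvZ
      · exact Or.inl ⟨hYR v hv, hvZ⟩
    have hsep1 : ∀ W, G'.Separates X (insert x Z) W → G.Separates X Y W := by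
      intro W hW a ha b hb p
      obtain ⟨z, hz, q, hq⟩ := exists_walk_to_boundary (G' := G') (U := R) (Z := Z) (x := x)
        (fun u hu v hux huv =>
          have := hadj' huv hux (fun e => hyR (e ▸ hu))
          ⟨this, hRc u hu v this⟩) p (hXR a ha) (hYR b hb)
      obtain ⟨w, hw, hw'⟩ := hW a ha z hz q
      exact ⟨w, hq hw, hw'⟩
    have hsep2 : ∀ W, G'.Separates Y (insert y Z) W → G.Separates X Y W := by
      intro W hW a ha b hb p
      obtain ⟨z, hz, q, hq⟩ := exists_walk_to_boundary (G' := G') (U := R') (Z := Z) (x := y)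
        (fun u hu v hux huv =>
          have := hadj' huv (fun e => hu.1 (e ▸ hxR)) hux
          ⟨this, hR'c u hu v this⟩) p.reverse (hYR' b hb)
        (fun hc => by rcases hXR a ha with h1 | h1; exacts [hc.1 h1, hc.2 h1])
      obtain ⟨w, hw, hw'⟩ := hW b hb z hz q
      exact ⟨w, by simpa using hq hw, hw'⟩
    have hcard : ∀ w, w ∉ Z → n ≤ (insert w Z).ncard → (insert w Z).ncard = n := by
      intro w hw hn
      rw [Set.ncard_insert_of_notMem hw] at hn ⊢
      omega
    have hc1 : (insert x Z).ncard = n := hcard x hxZ <| h _ <| hsep1 _ fun a ha b hb p =>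
      ⟨b, p.end_mem_support, hb⟩
    have hc2 : (insert y Z).ncard = n := hcard y hyZ <| h _ <| hsep2 _ fun a ha b hb p =>
      ⟨b, p.end_mem_support, hb⟩
    obtain ⟨a, b, p, ha, hb, hp, hd⟩ := ih _ hlt G' X (insert x Z) (fun W hW => h W (hsep1 W hW)) rfl
    obtain ⟨a', b', p', ha', hb', hp', hd'⟩ :=
      ih _ hlt G' Y (insert y Z) (fun W hW => h W (hsep2 W hW)) rfl
    obtain ⟨-, he⟩ := IsLinked.exists_index hb hd hc1
    obtain ⟨hs', he'⟩ := IsLinked.exists_index hb' hd' hc2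
    have hpR : ∀ i, ∀ v ∈ (p i).support, v ∈ R ∨ v ∈ Z := fun i =>
      (hp i).mem_or_mem_of_closed hRc (hXR _ (ha i)) fun v hv hvZ => he i v hv (Or.inr hvZ)
    have hpR' : ∀ i, ∀ v ∈ (p' i).support, v ∈ R' ∨ v ∈ Z := fun i =>
      (hp' i).mem_or_mem_of_closed hR'c (hYR' _ (ha' i)) fun v hv hvZ => he' i v hv (Or.inr hvZ)
    have hj : ∀ i, ∃ j, (b i = x ∧ b' j = y ∨ b i ∈ Z ∧ b' j = b i) := fun i => by
      rcases hb i with h1 | h1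
      · obtain ⟨j, hj⟩ := hs' y (Or.inl rfl)
        exact ⟨j, Or.inl ⟨h1, hj⟩⟩
      · obtain ⟨j, hj⟩ := hs' (b i) (Or.inr h1)
        exact ⟨j, Or.inr ⟨h1, hj⟩⟩
    choose j hj using hj
    have hbinj : ∀ i i', b i = b i' → i = i' := fun i i' e =>
      hd i i' (b i) (p i).end_mem_support (by rw [e]; exact (p i').end_mem_support)
    have hjinj : ∀ i i', j i = j i' → i = i' := fun i i' e => by
      apply hbinj
      rcases hj i with h1 | h1 <;> rcases hj i' with h2 | h2 <;> rw [e] at h1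
      · rw [h1.1, h2.1]
      · exact absurd (h1.2 ▸ h2.2 ▸ h2.1) hyZ
      · exact absurd (h2.2 ▸ h1.2 ▸ h1.1) hyZ
      · rw [← h1.2, h2.2]
    have hw : ∀ i, ∃ q : G.Walk (a i) (a' (j i)), q.IsPath ∧
        ∀ v ∈ q.support, v ∈ (p i).support ∨ v ∈ (p' (j i)).support := fun i => by
      obtain ⟨c, hc⟩ : ∃ c : G.Walk (b i) (b' (j i)), ∀ v ∈ c.support, v = b i ∨ v = b' (j i) := by
        rcases hj i with h1 | h1
        · exact ⟨(h1.1.symm ▸ h1.2.symm ▸ hxy : G.Adj (b i) (b' (j i))).toWalk, by simp⟩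
        · exact ⟨Walk.nil.copy rfl h1.2.symm, by simp⟩
      refine ⟨((((p i).mapLe hle).append c).append ((p' (j i)).mapLe hle).reverse).bypass,
        Walk.bypass_isPath _, fun v hv => ?_⟩
      have := Walk.support_bypass_subset_support _ hv
      simp only [Walk.mem_support_append_iff, Walk.support_mapLe_eq_support,
        Walk.support_reverse, List.mem_reverse] at this
      rcases this with (h1 | h1) | h1
      · exact Or.inl h1
      · rcases hc v h1 with rfl | rfl
        exacts [Or.inl (p i).end_mem_support, Or.inr (p' (j i)).end_mem_support]
      · exact Or.inr h1
    choose q hq hqs using hw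
    -- The two systems live in `R ∪ Z` and `R' ∪ Z`, so they can meet only in `Z`, that is, at glued
    -- ends.
    have hcross : ∀ i i' v, v ∈ (p i).support → v ∈ (p' (j i')).support → i = i' := by
      intro i i' v h1 h2
      have hvZ : v ∈ Z := by
        rcases hpR i v h1 with h3 | h3
        · rcases hpR' _ v h2 with h4 | h4
          exacts [absurd h3 h4.1, h4]
        · exact h3
      have e1 := he i v h1 (Or.inr hvZ)
      have e2 := he' _ v h2 (Or.inr hvZ)
      rcases hj i' with h3 | h3
      · exact absurd (h3.2 ▸ e2 ▸ hvZ) hyZ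
      · exact hbinj _ _ (e1.symm.trans (e2.trans h3.2))
    refine ⟨a, fun i => a' (j i), q, ha, fun i => ha' _, hq, fun i i' v h1 h2 => ?_⟩
    rcases hqs i v h1 with h3 | h3 <;> rcases hqs i' v h2 with h4 | h4
    · exact hd _ _ v h3 h4
    · exact hcross _ _ v h3 h4
    · exact (hcross _ _ v h4 h3).symm
    · exact hjinj _ _ (hd' _ _ v h3 h4)
  by_contra hcon
  have hns : ¬ G.Separates X Y Z := fun hs => absurd (h Z hs) (by omega)
  apply hns
  -- otherwise `R` is closed in `G` off `Z`
  have hRG : ∀ u ∈ R, ∀ v, G.Adj u v → v ∈ R ∨ v ∈ Z := by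
    intro u hu v huv
    by_contra! hv
    by_cases he : u = x₀ ∧ v = y₀ ∨ u = y₀ ∧ v = x₀
    · refine hcon (key u v huv ?_ hu hv.1 hv.2)
      rcases he with ⟨rfl, rfl⟩ | ⟨rfl, rfl⟩
      exacts [rfl, Sym2.eq_swap]
    · rcases hRc u hu v (hadj huv he) with h1 | h1
      exacts [hv.1 h1, hv.2 h1]
  intro a ha b hb p
  by_contra! hp
  have : ∀ v ∈ p.support, v ∈ R ∨ v ∈ Z := by
    have haR := hXR a ha
    clear ha hb
    induction p with
    | nil => simpa using haR
    | @cons u v w huv p ih =>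
      intro z hz
      rw [Walk.support_cons, List.mem_cons] at hz
      rcases hz with rfl | hz
      · exact haR
      · exact ih (fun z hz => hp z (by simp [hz]))
          (hRG u (haR.resolve_right (hp u (by simp))) v huv) z hz
  rcases this b p.end_mem_support with h1 | h1
  exacts [hYR b hb h1, hp b p.end_mem_support h1]

end SimpleGraph

/-! ### Chromatic number of vertex sets, critical sets, and a first cycle -/

namespace SimpleGraph

variable {V : Type u} {G : SimpleGraph V} {S T : Set V}

/-- The vertex set `S` can be properly coloured with the colours `0, …, q - 1`. -/
def IsColorableOn (G : SimpleGraph V) (S : Set V) (q : ℕ) : Prop :=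
  ∃ c : V → ℕ, (∀ v ∈ S, c v < q) ∧ ∀ u ∈ S, ∀ v ∈ S, G.Adj u v → c u ≠ c v

/-- The chromatic number of the subgraph induced by `S`. -/
noncomputable def chiOn (G : SimpleGraph V) (S : Set V) : ℕ := sInf {q | G.IsColorableOn S q}

theorem isColorableOn_iff_induce {q : ℕ} : G.IsColorableOn S q ↔ (G.induce S).Colorable q := by
  classical
  constructor
  · rintro ⟨c, hc, hc'⟩
    exact ⟨Coloring.mk (fun v : S => (⟨c v, hc v v.2⟩ : Fin q)) fun {u v} huv h =>
      hc' u u.2 v v.2 huv (by simpa using h)⟩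
  · rintro ⟨c⟩
    refine ⟨fun v => if h : v ∈ S then (c ⟨v, h⟩ : ℕ) else 0, fun v hv => by simp [hv],
      fun u hu v hv huv => ?_⟩
    have : c ⟨u, hu⟩ ≠ c ⟨v, hv⟩ := c.valid huv
    simpa [hu, hv, Fin.ext_iff] using this

theorem IsColorableOn.mono {q r : ℕ} (h : G.IsColorableOn S q) (hqr : q ≤ r) :
    G.IsColorableOn S r :=
  let ⟨c, hc, hc'⟩ := h
  ⟨c, fun v hv => (hc v hv).trans_le hqr, hc'⟩

variable [Finite V]

theorem isColorableOn_chiOn (G : SimpleGraph V) (S : Set V) : G.IsColorableOn S (G.chiOn S) := by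
  refine Nat.sInf_mem (s := {q | G.IsColorableOn S q}) ?_
  obtain ⟨n, ⟨e⟩⟩ := Finite.exists_equiv_fin V
  exact ⟨n, fun v => e v, fun v _ => (e v).2, fun u _ v _ huv h =>
    huv.ne (e.injective (Fin.ext h))⟩

theorem chiOn_le_iff {q : ℕ} : G.chiOn S ≤ q ↔ G.IsColorableOn S q :=
  ⟨fun h => (isColorableOn_chiOn G S).mono h, fun h => Nat.sInf_le h⟩

theorem chromaticNumber_induce (G : SimpleGraph V) (S : Set V) :
    (G.induce S).chromaticNumber = (G.chiOn S : ℕ∞) := by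
  refine le_antisymm ?_ ?_
  · rw [chromaticNumber_le_iff_colorable, ← isColorableOn_iff_induce]
    exact isColorableOn_chiOn G S
  · refine le_chromaticNumber_iff_colorable.2 fun m hm => ?_
    exact chiOn_le_iff.2 (isColorableOn_iff_induce.2 hm)

theorem chiOn_mono (h : S ⊆ T) : G.chiOn S ≤ G.chiOn T := by
  obtain ⟨c, hc, hc'⟩ := isColorableOn_chiOn G T
  exact chiOn_le_iff.2 ⟨c, fun v hv => hc v (h hv), fun u hu v hv => hc' u (h hu) v (h hv)⟩

theorem chiOn_empty : G.chiOn ∅ = 0 :=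
  Nat.le_zero.1 <| chiOn_le_iff.2 ⟨fun _ => 0, by simp, by simp⟩

theorem chiOn_singleton_le (v : V) : G.chiOn {v} ≤ 1 :=
  chiOn_le_iff.2 ⟨fun _ => 0, by simp, by simp⟩

theorem chiOn_union_le (G : SimpleGraph V) (S T : Set V) :
    G.chiOn (S ∪ T) ≤ G.chiOn S + G.chiOn T := by
  classical
  obtain ⟨c, hc, hc'⟩ := isColorableOn_chiOn G S
  obtain ⟨d, hd, hd'⟩ := isColorableOn_chiOn G T
  refine chiOn_le_iff.2 ⟨fun v => if v ∈ S then c v else G.chiOn S + d v, fun v hv => ?_,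
    fun u hu v hv huv => ?_⟩
  · dsimp only
    split_ifs with h
    · have := hc v h
      omega
    · have := hd v (hv.resolve_left h)
      omega
  · dsimp only
    split_ifs with h h' h'
    · exact hc' u h v h' huv
    · have := hc u h
      omega
    · have := hc v h'
      omega
    · have := hd' u (hu.resolve_left h) v (hv.resolve_left h') huv
      omega

theorem exists_critical (G : SimpleGraph V) (S : Set V) :
    ∃ T ⊆ S, G.chiOn T = G.chiOn S ∧ ∀ U ⊂ T, G.chiOn U < G.chiOn S := by
  obtain ⟨T, ⟨h1, h2⟩, hmin⟩ :=
    Set.exists_min_image {T : Set V | T ⊆ S ∧ G.chiOn T = G.chiOn S} Set.ncard (Set.toFinite _)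
      ⟨S, subset_rfl, rfl⟩
  refine ⟨T, h1, h2, fun U hU => lt_of_le_of_ne (h2 ▸ chiOn_mono hU.1) fun he => ?_⟩
  exact absurd (hmin U ⟨hU.1.trans h1, he⟩) (Set.ncard_lt_ncard hU (Set.toFinite _)).not_ge

/-- Keep an `r`-colouring of `T` off `I` and recolour `I` with colours not used on `B`; at least `r
- |B|` of these remain. -/
theorem chiOn_union_le_of_boundary {I B : Set V} {r : ℕ} (hT : G.chiOn T ≤ r)
    (hB : ∀ u ∈ T, ∀ v ∈ I, G.Adj u v → u ∈ B) (hr : B.ncard + G.chiOn I ≤ r) :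
    G.chiOn (T ∪ I) ≤ r := by
  classical
  obtain ⟨c, hc, hc'⟩ := chiOn_le_iff.1 hT
  obtain ⟨d, hd, hd'⟩ := isColorableOn_chiOn G I
  set F : Finset ℕ := Finset.range r \ (B.toFinite.toFinset.image c) with hF
  have hcard : G.chiOn I ≤ F.card := by
    have h1 := Finset.le_card_sdiff (B.toFinite.toFinset.image c) (Finset.range r)
    have h2 : (B.toFinite.toFinset.image c).card ≤ B.ncard := by
      rw [Set.ncard_eq_toFinset_card B]
      exact Finset.card_image_le
    rw [Finset.card_range, ← hF] at h1
    omega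
  set e := F.orderEmbOfCardLe hcard
  have he : ∀ i, e i < r ∧ ∀ u ∈ B, e i ≠ c u := fun i => by
    have := Finset.orderEmbOfCardLe_mem F hcard i
    simp only [hF, Finset.mem_sdiff, Finset.mem_range, Finset.mem_image,
      Set.Finite.mem_toFinset, not_exists, not_and] at this
    exact ⟨this.1, fun u hu h => this.2 u hu h.symm⟩
  refine chiOn_le_iff.2 ⟨fun v => if h : v ∈ I then e ⟨d v, hd v h⟩ else c v, fun v hv => ?_,
    fun u hu v hv huv => ?_⟩
  · dsimp only
    split_ifs with h
    · exact (he _).1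
    · exact hc v (hv.resolve_right h)
  · dsimp only
    split_ifs with h h' h'
    · intro heq
      have := e.injective heq
      exact hd' u h v h' huv (by simpa using this)
    · exact (he _).2 v (hB v (hv.resolve_right h') u h huv.symm)
    · exact ((he _).2 u (hB u (hu.resolve_right h) v h' huv)).symm
    · exact hc' u (hu.resolve_right h) v (hv.resolve_right h') huv

/-- The vertex set `S` contains a cycle of length `n`. -/
def HasCycleIn (G : SimpleGraph V) (S : Set V) (n : ℕ) : Prop :=
  ∃ (v : V) (p : G.Walk v v), p.IsCycle ∧ p.length = n ∧ ∀ w ∈ p.support, w ∈ S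

theorem le_ncard_neighbors_of_critical (hcrit : ∀ U ⊂ T, G.chiOn U < G.chiOn T) {v : V}
    (hv : v ∈ T) : G.chiOn T ≤ {w ∈ T | G.Adj v w}.ncard + 1 := by
  by_contra! hlt
  have h1 : G.chiOn (T \ {v}) < G.chiOn T := hcrit _ ⟨Set.sdiff_subset, fun h => (h hv).2 rfl⟩
  have h2 := chiOn_union_le_of_boundary (G := G) (T := T \ {v}) (I := {v})
    (B := {w ∈ T | G.Adj v w}) (r := G.chiOn T - 1) (by omega)
    (fun u hu w hw huw => by
      rw [Set.mem_singleton_iff] at hw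
      subst hw
      exact ⟨hu.1, huw.symm⟩)
    (by have := chiOn_singleton_le (G := G) v; omega)
  rw [Set.sdiff_union_of_subset (by simpa using hv)] at h2
  omega

theorem exists_longest_path_in (G : SimpleGraph V) (hS : S.Nonempty) :
    ∃ (u v : V) (p : G.Walk u v), p.IsPath ∧ (∀ w ∈ p.support, w ∈ S) ∧
      ∀ (u' v' : V) (q : G.Walk u' v'), q.IsPath → (∀ w ∈ q.support, w ∈ S) →
        q.length ≤ p.length := by
  have := Fintype.ofFinite V
  obtain ⟨x, hx⟩ := hS
  set L : Set ℕ := {n | ∃ (u v : V) (p : G.Walk u v), p.IsPath ∧ (∀ w ∈ p.support, w ∈ S) ∧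
    p.length = n} with hL
  have hfin : L.Finite := Set.Finite.subset (Set.finite_le_nat (Fintype.card V))
    fun n ⟨_, _, _, hp, _, hn⟩ => hn ▸ hp.length_lt.le
  obtain ⟨n, ⟨u, v, p, hp, hpS, rfl⟩, hmax⟩ := Set.exists_max_image L id hfin
    ⟨0, x, x, .nil, .nil, by simpa using hx, rfl⟩
  exact ⟨u, v, p, hp, hpS, fun u' v' q hq hqS => hmax _ ⟨u', v', q, hq, hqS, rfl⟩⟩

/-- In a critical set each vertex has at least `χ - 1` neighbours. For an end of a longest path they
all lie on the path, and the farthest one closes a cycle of length at least `χ`. -/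
theorem exists_cycle_of_chiOn (h : 3 ≤ G.chiOn S) :
    ∃ n, G.chiOn S ≤ n ∧ G.HasCycleIn S n := by
  classical
  obtain ⟨T, hTS, hT, hcrit⟩ := exists_critical G S
  rw [← hT] at hcrit
  have hne : T.Nonempty := by
    rw [Set.nonempty_iff_ne_empty]
    rintro rfl
    rw [chiOn_empty] at hT
    omega
  obtain ⟨u, v, p, hp, hpT, hmax⟩ := exists_longest_path_in G hne
  have hdeg := le_ncard_neighbors_of_critical hcrit (hpT u p.start_mem_support)
  have hN : ∀ w ∈ T, G.Adj u w → ∃ i, i ≤ p.length ∧ p.getVert i = w := by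
    intro w hw huw
    by_contra! hcon
    have hwp : w ∉ p.support := fun hw => by
      obtain ⟨i, h1, h2⟩ := Walk.mem_support_iff_exists_getVert.1 hw
      exact hcon i h2 h1
    have := hmax _ _ (.cons huw.symm p) (hp.cons hwp) (by simpa using ⟨hw, hpT⟩)
    simp at this
  set J : Finset ℕ := {i ∈ Finset.range (p.length + 1) | G.Adj u (p.getVert i)} with hJ
  have hJcard : G.chiOn T ≤ J.card + 1 := by
    refine hdeg.trans (Nat.succ_le_succ ?_)
    have : {w ∈ T | G.Adj u w} ⊆ p.getVert '' (J : Set ℕ) := by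
      rintro w ⟨hw, huw⟩
      obtain ⟨i, hi, rfl⟩ := hN w hw huw
      exact ⟨i, by simp [hJ, huw]; omega, rfl⟩
    calc _ ≤ (p.getVert '' (J : Set ℕ)).ncard := Set.ncard_le_ncard this (Set.toFinite _)
      _ ≤ (J : Set ℕ).ncard := Set.ncard_image_le (Set.toFinite _)
      _ = _ := Set.ncard_coe_finset J
  have hJne : J.Nonempty := Finset.card_pos.1 (by omega)
  set m := J.max' hJne with hm
  have hmJ : m ∈ J := J.max'_mem hJne
  -- The indices of the neighbours lie in `1, …, m`, so `m ≥ χ - 1` and the cycle through `m + 1`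
  -- path vertices is long enough.
  have hsub : J ⊆ Finset.Icc 1 m := by
    intro i hi
    refine Finset.mem_Icc.2 ⟨?_, J.le_max' i hi⟩
    by_contra! h0
    have : i = 0 := by omega
    subst this
    simp [hJ] at hi
  have hcm := Finset.card_le_card hsub
  rw [Nat.card_Icc] at hcm
  simp only [hJ, Finset.mem_filter, Finset.mem_range] at hmJ
  have hlen : (p.take m).length = m := by rw [Walk.take_length]; omega
  refine ⟨m + 1, by omega, p.getVert m, .append hmJ.2.symm.toWalk (p.take m), ?_, ?_, ?_⟩
  · refine Walk.IsPath.isCycle_append hmJ.2.symm.isPath_toWalk (hp.take m) ?_ (by omega)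
    have := (hp.take m).support_nodup
    rw [← Walk.cons_tail_support, List.nodup_cons] at this
    simpa using this.1
  · simp [hlen, add_comm]
  · intro w hw
    rw [Walk.mem_support_append_iff] at hw
    have hsub : ∀ w ∈ (p.take m).support, w ∈ S := fun w hw =>
      hTS (hpT w ((p.isSubwalk_take m).support_subset hw))
    rcases hw with hw | hw
    · simp only [Adj.support_toWalk, List.mem_cons, List.not_mem_nil, or_false] at hw
      rcases hw with rfl | rfl
      exacts [hsub _ (Walk.end_mem_support _), hsub _ (Walk.start_mem_support _)]
    · exact hsub w hw

end SimpleGraph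

/-! ### Cycle surgery and the dominant cycle -/

namespace SimpleGraph

variable {V : Type u} {G : SimpleGraph V} {S T : Set V}

theorem Walk.IsPath.append_of_inter {u v w : V} {p : G.Walk u v} {q : G.Walk v w} (hp : p.IsPath)
    (hq : q.IsPath) (h : ∀ z ∈ p.support, z ∈ q.support → z = v) : (p.append q).IsPath := by
  rw [Walk.isPath_def, Walk.support_append, List.nodup_append']
  have hq' := hq.support_nodup
  rw [← Walk.cons_tail_support, List.nodup_cons] at hq'
  refine ⟨hp.support_nodup, hq'.2, fun z hz hz' => ?_⟩
  have := h z hz (List.mem_of_mem_tail hz')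
  subst this
  exact hq'.1 hz'

theorem Walk.IsPath.isCycle_append_of_inter {u v : V} {p : G.Walk u v} {q : G.Walk v u}
    (hp : p.IsPath) (hq : q.IsPath) (h : ∀ z ∈ p.support, z ∈ q.support → z = u ∨ z = v)
    (hl : 3 ≤ p.length + q.length) : (p.append q).IsCycle := by
  refine hp.isCycle_append hq (fun z hz hz' => ?_) (by omega)
  have hp' := hp.support_nodup
  have hq' := hq.support_nodup
  rw [← Walk.cons_tail_support, List.nodup_cons] at hp' hq'
  rcases h z (List.mem_of_mem_tail hz) (List.mem_of_mem_tail hz') with rfl | rfl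
  exacts [hp'.1 hz, hq'.1 hz']

/-- Two vertices of a cycle split it into two paths. -/
theorem Walk.IsCycle.exists_arcs {v : V} {c : G.Walk v v} (hc : c.IsCycle) {i k : ℕ} (hk : 0 < k)
    (hik : i + k < c.length) :
    ∃ (p : G.Walk (c.getVert i) (c.getVert (i + k))) (q : G.Walk (c.getVert (i + k)) (c.getVert i)),
      p.IsPath ∧ q.IsPath ∧ p.length = k ∧ q.length = c.length - k ∧
        p.support ⊆ c.support ∧ q.support ⊆ c.support := by
  have hv : (c.drop i).getVert k = c.getVert (i + k) := by rw [Walk.drop_getVert]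
  rw [← hv]
  set D := c.drop i with hD
  have hl1 : (c.take i).length = i := by rw [Walk.take_length]; omega
  have hl2 : D.length = c.length - i := by rw [hD, Walk.drop_length]
  have hl3 : (D.take k).length = k := by rw [Walk.take_length]; omega
  have hl4 : (D.drop k).length = c.length - i - k := by rw [Walk.drop_length, hl2]
  have hDs : D.support ⊆ c.support := (c.isSubwalk_drop i).support_subset
  have hs := hc.support_nodup
  have hspec : (c.take i).append ((D.take k).append (D.drop k)) = c := by
    rw [Walk.append_take_drop_eq, hD, Walk.append_take_drop_eq]
  rw [← hspec, Walk.tail_support_append, Walk.tail_support_append, List.nodup_append',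
    List.nodup_append'] at hs
  obtain ⟨h1, ⟨h2, h3, h23⟩, h1'⟩ := hs
  have hmem : D.getVert k ∈ (D.take k).support.tail := Walk.end_mem_tail_support
    (by rw [← Walk.length_eq_zero_iff.not]; omega)
  refine ⟨D.take k, (D.drop k).append (c.take i), ?_, ?_, hl3, ?_, ?_, ?_⟩
  · by_cases hi : 0 < i
    · exact (hc.isPath_drop hi).take k
    · have hi0 : i = 0 := by omega
      have hT : (c.take (i + k)).IsPath := hc.isPath_take hik
      subst hi0
      rw [Walk.isPath_def, Walk.support_take]
      rw [Walk.isPath_def, Walk.support_take] at hT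
      simpa [hD] using hT
  · rw [Walk.isPath_def, Walk.support_append, ← Walk.cons_tail_support (D.drop k), List.cons_append,
      List.nodup_cons, List.nodup_append', List.mem_append, not_or]
    exact ⟨⟨fun h => h23 hmem h, fun h => h1' h (List.mem_append_left _ hmem)⟩, h3, h1,
      fun z hz hz' => h1' hz' (List.mem_append_right _ hz)⟩
  · rw [Walk.length_append]; omega
  · exact fun z hz => hDs ((D.isSubwalk_take k).support_subset hz)
  · intro z hz
    rcases (Walk.mem_support_append_iff _ _).1 hz with hz | hz
    · exact hDs ((D.isSubwalk_drop k).support_subset hz)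
    · exact (c.isSubwalk_take i).support_subset hz

theorem Walk.exists_getVert_eq_of_mem_support {v : V} {c : G.Walk v v} (hc : ¬ c.Nil) {x : V}
    (hx : x ∈ c.support) : ∃ i < c.length, c.getVert i = x := by
  obtain ⟨i, rfl, hi⟩ := Walk.mem_support_iff_exists_getVert.1 hx
  rcases hi.lt_or_eq with hi | rfl
  · exact ⟨i, hi, rfl⟩
  · refine ⟨0, ?_, by simp⟩
    rw [← Walk.length_eq_zero_iff] at hc
    omega

theorem Walk.IsCycle.exists_long_arc {v : V} {c : G.Walk v v} (hc : c.IsCycle) {x y : V}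
    (hx : x ∈ c.support) (hy : y ∈ c.support) (hxy : x ≠ y) :
    ∃ p : G.Walk x y, p.IsPath ∧ c.length ≤ 2 * p.length ∧ p.support ⊆ c.support := by
  obtain ⟨i, hi, rfl⟩ := Walk.exists_getVert_eq_of_mem_support hc.not_nil hx
  obtain ⟨j, hj, rfl⟩ := Walk.exists_getVert_eq_of_mem_support hc.not_nil hy
  rcases lt_trichotomy i j with h | rfl | h
  · obtain ⟨k, rfl⟩ := Nat.exists_eq_add_of_lt h
    obtain ⟨p, q, hp, hq, hpl, hql, hps, hqs⟩ := hc.exists_arcs (i := i) (k := k + 1) (by omega) hj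
    by_cases hk : c.length ≤ 2 * p.length
    · exact ⟨p, hp, hk, hps⟩
    · exact ⟨q.reverse, hq.reverse, by rw [Walk.length_reverse]; omega, by
        intro z hz
        exact hqs (by simpa using hz)⟩
  · exact absurd rfl hxy
  · obtain ⟨k, rfl⟩ := Nat.exists_eq_add_of_lt h
    obtain ⟨p, q, hp, hq, hpl, hql, hps, hqs⟩ := hc.exists_arcs (i := j) (k := k + 1) (by omega) hi
    by_cases hk : c.length ≤ 2 * q.length
    · exact ⟨q, hq, hk, hqs⟩
    · exact ⟨p.reverse, hp.reverse, by rw [Walk.length_reverse]; omega, by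
        intro z hz
        exact hps (by simpa using hz)⟩

theorem Walk.IsCycle.ncard_support {v : V} {c : G.Walk v v} (hc : c.IsCycle) :
    {w | w ∈ c.support}.ncard = c.length := by
  classical
  have h : {w | w ∈ c.support} = (c.support.tail.toFinset : Set V) := by
    ext w
    rw [Set.mem_ofPred_eq, List.coe_toFinset, Set.mem_ofPred_eq, ← Walk.cons_tail_support,
      List.mem_cons, List.tail_cons]
    refine ⟨?_, Or.inr⟩
    rintro (rfl | h)
    exacts [c.end_mem_tail_support hc.not_nil, h]
  rw [h, Set.ncard_coe_finset, List.toFinset_card_of_nodup hc.support_nodup]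
  simp

theorem Walk.exists_path_between_sets {X Y : Set V} {a b : V} (p : G.Walk a b) (ha : a ∈ X)
    (hb : b ∈ Y) : ∃ x ∈ X, ∃ y ∈ Y, ∃ q : G.Walk x y, q.IsPath ∧ q.support ⊆ p.support ∧
      (∀ w ∈ q.support, w ∈ X → w = x) ∧ ∀ w ∈ q.support, w ∈ Y → w = y := by
  classical
  have hex : ∃ n, ∃ x ∈ X, ∃ y ∈ Y, ∃ q : G.Walk x y, q.IsPath ∧ q.support ⊆ p.support ∧
      q.length = n :=
    ⟨_, a, ha, b, hb, p.bypass, p.bypass_isPath, p.support_bypass_subset_support, rfl⟩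
  obtain ⟨x, hx, y, hy, q, hq, hqs, hql⟩ := Nat.find_spec hex
  refine ⟨x, hx, y, hy, q, hq, hqs, fun w hw hwX => ?_, fun w hw hwY => ?_⟩
  · by_contra hne
    refine Nat.find_min hex (m := (q.dropUntil w hw).length) ?_ ⟨w, hwX, y, hy, _, hq.dropUntil hw,
      fun z hz => hqs (q.support_dropUntil_subset_support hw hz), rfl⟩
    rw [← hql]
    exact Walk.length_dropUntil_lt_length hw hne
  · by_contra hne
    refine Nat.find_min hex (m := (q.takeUntil w hw).length) ?_ ⟨x, hx, w, hwY, _, hq.takeUntil hw,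
      fun z hz => hqs (q.support_takeUntil_subset_support hw hz), rfl⟩
    rw [← hql]
    exact Walk.length_takeUntil_lt_length hw hne

theorem HasCycleIn.mono {n : ℕ} (h : G.HasCycleIn S n) (hST : S ⊆ T) : G.HasCycleIn T n :=
  let ⟨v, p, hp, hn, hs⟩ := h
  ⟨v, p, hp, hn, fun w hw => hST (hs w hw)⟩

variable [Finite V]

/-- Inside a critical set `T`, take `A` smallest with boundary at most `2t` and nonempty interior.
Removing the interior lowers the chromatic number, so `A` must carry all but `2t` of it: otherwise
the interior could be coloured back. -/
theorem exists_unseparable_subset (G : SimpleGraph V) (S : Set V) (t : ℕ) :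
    ∃ A ⊆ S, G.chiOn S ≤ G.chiOn A + 2 * t ∧
      ∀ A₁ A₂ : Set V, A₁ ∪ A₂ = A → (∀ u ∈ A₁ \ A₂, ∀ v ∈ A₂ \ A₁, ¬ G.Adj u v) →
        (A₁ ∩ A₂).ncard ≤ t → A₁.ncard ≤ 2 * t ∨ A₂.ncard ≤ 2 * t := by
  obtain ⟨T, hTS, hT, hcrit⟩ := exists_critical G S
  rcases T.eq_empty_or_nonempty with rfl | hne
  · rw [chiOn_empty] at hT
    exact ⟨∅, hTS, by omega, fun A₁ A₂ h _ _ => Or.inl (by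
      rw [(Set.union_empty_iff.1 h).1, Set.ncard_empty]; omega)⟩
  set bd : Set V → Set V := fun A => {v ∈ A | ∃ w ∈ T \ A, G.Adj v w} with hbd
  obtain ⟨A, ⟨hAT, hAb, hAi⟩, hmin⟩ :=
    Set.exists_min_image {A : Set V | A ⊆ T ∧ (bd A).ncard ≤ 2 * t ∧ (A \ bd A).Nonempty} Set.ncard
      (Set.toFinite _) ⟨T, subset_rfl, by simp [hbd], by simpa [hbd] using hne⟩
  refine ⟨A, hAT.trans hTS, ?_, fun A₁ A₂ hA hadj hcap => ?_⟩
  · by_contra! hlt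
    have h1 : G.chiOn (T \ (A \ bd A)) < G.chiOn S := hcrit _
      ⟨Set.sdiff_subset, fun h => by
        obtain ⟨v, hv⟩ := hAi
        exact (h (hAT hv.1)).2 hv⟩
    have h2 := chiOn_union_le_of_boundary (G := G) (T := T \ (A \ bd A)) (I := A \ bd A)
      (B := bd A) (r := G.chiOn S - 1) (by omega)
      (fun u hu v hv huv => by
        by_contra hub
        have huA : u ∉ A := fun h => hu.2 ⟨h, hub⟩
        exact hv.2 ⟨hv.1, u, ⟨hu.1, huA⟩, huv.symm⟩)
      (by have := chiOn_mono (G := G) (Set.sdiff_subset : A \ bd A ⊆ A); omega)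
    rw [Set.sdiff_union_of_subset (Set.sdiff_subset.trans hAT)] at h2
    omega
  -- A proper side with more than `2t` vertices must have boundary more than `2t`, by minimality of
  -- `A`. Two such sides have boundaries summing to more than `4t`, yet the sum is at most `|bd A| +
  -- 2 |A₁ ∩ A₂| ≤ 4t`.
  · have aux : ∀ A₁ A₂ : Set V, A₁ ∪ A₂ = A → (∀ u ∈ A₁ \ A₂, ∀ v ∈ A₂ \ A₁, ¬ G.Adj u v) →
        ¬ A₁.ncard ≤ 2 * t → A₁ ≠ A → 2 * t < (bd A₁).ncard ∧ bd A₁ ⊆ (bd A \ A₂) ∪ (A₁ ∩ A₂) := by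
      intro A₁ A₂ hA hadj hc hneq
      have hss : A₁ ⊆ A := hA ▸ Set.subset_union_left
      refine ⟨?_, ?_⟩
      · by_contra! hle
        have hne1 : (A₁ \ bd A₁).Nonempty := by
          by_contra! hem
          exact hc ((Set.ncard_le_ncard (Set.sdiff_eq_empty.1 hem) (Set.toFinite _)).trans hle)
        exact absurd (hmin A₁ ⟨hss.trans hAT, hle, hne1⟩)
          (Set.ncard_lt_ncard (hss.ssubset_of_ne hneq) (Set.toFinite _)).not_ge
      · rintro v ⟨hv, w, hw, hvw⟩
        by_cases hv2 : v ∈ A₂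
        · exact Or.inr ⟨hv, hv2⟩
        refine Or.inl ⟨⟨hss hv, w, ⟨hw.1, fun hwA => ?_⟩, hvw⟩, hv2⟩
        rw [← hA] at hwA
        exact hadj v ⟨hv, hv2⟩ w ⟨hwA.resolve_left hw.2, hw.2⟩ hvw
    by_contra! hcon
    have hn1 : A₁ ≠ A := by
      rintro rfl
      rw [Set.inter_eq_right.2 (hA ▸ Set.subset_union_right)] at hcap
      omega
    have hn2 : A₂ ≠ A := by
      rintro rfl
      rw [Set.inter_eq_left.2 (hA ▸ Set.subset_union_left)] at hcap
      omega
    obtain ⟨h1, h1'⟩ := aux A₁ A₂ hA hadj (by omega) hn1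
    obtain ⟨h2, h2'⟩ := aux A₂ A₁ (by rw [Set.union_comm, hA])
      (fun u hu v hv h => hadj v hv u hu h.symm) (by omega) hn2
    rw [Set.inter_comm] at h2'
    have e1 := (Set.ncard_le_ncard h1' (Set.toFinite _)).trans (Set.ncard_union_le _ _)
    have e2 := (Set.ncard_le_ncard h2' (Set.toFinite _)).trans (Set.ncard_union_le _ _)
    have e3 : (bd A \ A₂).ncard + (bd A \ A₁).ncard ≤ (bd A).ncard := by
      rw [← Set.ncard_union_eq ?_ (Set.toFinite _) (Set.toFinite _)]
      · exact Set.ncard_le_ncard (Set.union_subset Set.sdiff_subset Set.sdiff_subset)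
          (Set.toFinite _)
      · rw [Set.disjoint_left]
        rintro v ⟨hv, hv2⟩ ⟨-, hv1⟩
        have := hv.1
        rw [← hA] at this
        exact this.elim hv1 hv2
    omega

/-- Menger's theorem inside `A`: a separator of at most `t` vertices would give a separation whose
sides contain `X` and `Y`, both too large. -/
theorem exists_disjoint_paths_of_unseparable {A X Y : Set V} {t : ℕ}
    (hA : ∀ A₁ A₂ : Set V, A₁ ∪ A₂ = A → (∀ u ∈ A₁ \ A₂, ∀ v ∈ A₂ \ A₁, ¬ G.Adj u v) →
        (A₁ ∩ A₂).ncard ≤ t → A₁.ncard ≤ 2 * t ∨ A₂.ncard ≤ 2 * t)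
    (hX : X ⊆ A) (hY : Y ⊆ A) (hXc : 2 * t < X.ncard) (hYc : 2 * t < Y.ncard) :
    ∃ (a b : Fin (t + 1) → V) (p : ∀ i, G.Walk (a i) (b i)),
      (∀ i, a i ∈ X) ∧ (∀ i, b i ∈ Y) ∧ (∀ i, (p i).IsPath) ∧
      (∀ i, ∀ v ∈ (p i).support, v ∈ A) ∧
      (∀ i, ∀ v ∈ (p i).support, v ∈ X → v = a i) ∧
      (∀ i, ∀ v ∈ (p i).support, v ∈ Y → v = b i) ∧
      ∀ i j v, v ∈ (p i).support → v ∈ (p j).support → i = j := by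
  set G' := (G.induce A).spanningCoe with hG'
  have hadj : ∀ u v, G'.Adj u v ↔ u ∈ A ∧ v ∈ A ∧ G.Adj u v := by
    intro u v
    simp [hG']
    tauto
  have hle : G' ≤ G := fun u v h => ((hadj u v).1 h).2.2
  have hsup : ∀ {u v} (p : G'.Walk u v), u ∈ A → ∀ w ∈ p.support, w ∈ A := by
    intro u v p hu
    induction p with
    | nil => simpa using hu
    | cons h p ih => simpa [hu] using ih ((hadj _ _).1 h).2.1
  have hlink : G'.IsLinked X Y (t + 1) := by
    refine isLinked_of_forall_separates _ _ _ _ fun Z hZ => ?_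
    by_contra! hlt
    set R : Set V := {v | ∃ a ∈ X, ∃ p : G'.Walk a v, ∀ w ∈ p.support, w ∉ Z} with hR
    have hRA : R ⊆ A := fun v ⟨a, ha, p, _⟩ => hsup p (hX ha) v p.end_mem_support
    have hRZ : ∀ v ∈ R, v ∉ Z := fun v ⟨a, _, p, hp⟩ => hp v p.end_mem_support
    have := hA (R ∪ (Z ∩ A)) (A \ R) (by
        ext v
        simp only [Set.mem_union, Set.mem_inter_iff, Set.mem_sdiff]
        have := @hRA v
        tauto)
      (by
        rintro u ⟨hu, hu'⟩ v ⟨hv, hv'⟩ huv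
        have huR : u ∈ R := by
          by_contra hc
          exact hu' ⟨(hu.resolve_left hc).2, hc⟩
        obtain ⟨a, ha, p, hp⟩ := huR
        refine hv' (Or.inl ⟨a, ha, p.concat ((hadj _ _).2 ⟨hsup p (hX ha) u p.end_mem_support,
          hv.1, huv⟩), fun w hw => ?_⟩)
        rw [Walk.support_concat, List.mem_append, List.mem_singleton] at hw
        rcases hw with hw | rfl
        · exact hp w hw
        · exact fun hwZ => hv' (Or.inr ⟨hwZ, hv.1⟩))
      (by
        refine (Set.ncard_le_ncard (t := Z) ?_ (Set.toFinite _)).trans (by omega)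
        rintro v ⟨h1, h2⟩
        exact (h1.resolve_left h2.2).1)
    have h1 : X.ncard ≤ (R ∪ (Z ∩ A)).ncard := by
      refine Set.ncard_le_ncard (fun v hv => ?_) (Set.toFinite _)
      by_cases hvZ : v ∈ Z
      · exact Or.inr ⟨hvZ, hX hv⟩
      · exact Or.inl ⟨v, hv, .nil, by simpa using hvZ⟩
    have h2 : Y.ncard ≤ (A \ R).ncard := by
      refine Set.ncard_le_ncard (fun v hv => ⟨hY hv, ?_⟩) (Set.toFinite _)
      rintro ⟨a, ha, p, hp⟩
      obtain ⟨z, hz, hz'⟩ := hZ a ha v hv p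
      exact hp z hz hz'
    omega
  obtain ⟨a, b, p, ha, hb, hp, hd⟩ := hlink
  have hq := fun i => ((p i).mapLe hle).exists_path_between_sets (ha i) (hb i)
  simp only [Walk.support_mapLe_eq_support] at hq
  choose x hx y hy q hq hqs hqX hqY using hq
  exact ⟨x, y, q, hx, hy, hq, fun i v hv => hsup (p i) (hX (ha i)) v (hqs i hv), hqX, hqY,
    fun i j v h1 h2 => hd i j v (hqs i h1) (hqs j h2)⟩

theorem HasCycleIn.le_ncard {n : ℕ} (h : G.HasCycleIn S n) : n ≤ S.ncard := by
  obtain ⟨v, p, hp, rfl, hs⟩ := h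
  rw [← hp.ncard_support]
  exact Set.ncard_le_ncard hs (Set.toFinite _)

theorem exists_longest_cycle {n : ℕ} (h : G.HasCycleIn S n) :
    ∃ m, G.HasCycleIn S m ∧ ∀ k, G.HasCycleIn S k → k ≤ m := by
  obtain ⟨m, hm, hmax⟩ := Set.exists_max_image {m | G.HasCycleIn S m} id
    ((Set.finite_le_nat S.ncard).subset fun k hk => hk.le_ncard) ⟨n, h⟩
  exact ⟨m, hm, hmax⟩

/-- Pigeonhole: `t + 1` positions fall into `t` intervals of length `c / t`. -/
theorem exists_close_pair {c t : ℕ} (hc : 0 < c) (ht : 0 < t) (pos : Fin (t + 1) → ℕ) (hpos : ∀ i, pos i < c)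
    (hinj : Function.Injective pos) : ∃ i j, pos i < pos j ∧ (pos j - pos i) * t < c := by
  obtain ⟨i, -, j, -, hij, he⟩ := Finset.exists_ne_map_eq_of_card_lt_of_maps_to
    (s := (Finset.univ : Finset (Fin (t + 1)))) (t := Finset.range t) (by simp)
    (f := fun i => pos i * t / c) (fun i _ => by
      simp only [Finset.coe_range, Set.mem_Iio]
      rw [Nat.div_lt_iff_lt_mul hc, mul_comm]
      exact Nat.mul_lt_mul_of_pos_left (hpos i) ht)
  have hne := hinj.ne hij
  have key : ∀ i j, pos i < pos j → pos i * t / c = pos j * t / c → (pos j - pos i) * t < c := by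
    intro i j hlt he
    have h1 := Nat.div_add_mod (pos i * t) c
    have h2 := Nat.div_add_mod (pos j * t) c
    have h3 := Nat.mod_lt (pos j * t) hc
    rw [Nat.sub_mul]
    rw [he] at h1
    omega
  rcases hne.lt_or_gt with h | h
  exacts [⟨i, j, h, key i j h he⟩, ⟨j, i, h, key j i h he.symm⟩]

/-- A cycle `C` and a disjoint set `H` that together carry almost all of the chromatic number of
`S`, such that `C` is much longer than the cycles in `H`. -/
theorem exists_dominant_cycle (G : SimpleGraph V) (S : Set V) {t : ℕ} (ht : 1 ≤ t)
    (hS : 2 * t + 3 ≤ G.chiOn S) :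
    ∃ C H : Set V, C ⊆ S ∧ H ⊆ S ∧ Disjoint C H ∧ G.HasCycleIn C C.ncard ∧
      G.chiOn S ≤ G.chiOn C + G.chiOn H + 2 * t ∧
      (2 * t < G.chiOn H → ∀ n, G.HasCycleIn H n → t * n ≤ 2 * C.ncard) := by
  obtain ⟨A, hAS, hchi, hA⟩ := exists_unseparable_subset G S t
  obtain ⟨n₀, -, hn₀⟩ := exists_cycle_of_chiOn (G := G) (S := A) (by omega)
  obtain ⟨m, ⟨v, c, hc, hcl, hcA⟩, hmax⟩ := exists_longest_cycle hn₀
  set C : Set V := {w | w ∈ c.support} with hC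
  have hCc : C.ncard = m := by rw [hC, hc.ncard_support, hcl]
  have hCA : C ⊆ A := hcA
  refine ⟨C, A \ C, hCA.trans hAS, Set.sdiff_subset.trans hAS, Set.disjoint_sdiff_right,
    ⟨v, c, hc, by rw [hCc, hcl], fun w hw => hw⟩, ?_, fun hH => ?_⟩
  · have := chiOn_union_le G C (A \ C)
    rw [Set.union_sdiff_cancel hCA] at this
    omega
  -- Cycles with at most `2t` vertices provide too few endpoints for the linkage, but `2t < χ(H)`
  -- supplies a cycle longer than `2t` whose bound covers them.
  suffices key : ∀ n, 2 * t < n → G.HasCycleIn (A \ C) n → t * n ≤ 2 * C.ncard by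
    intro n hn
    obtain ⟨n', hn', hn''⟩ := exists_cycle_of_chiOn (G := G) (S := A \ C) (by omega)
    by_cases hle : 2 * t < n
    · exact key n hle hn
    · exact (Nat.mul_le_mul_left t (by omega)).trans (key n' (by omega) hn'')
  rintro n hn ⟨v', c', hc', hcl', hcA'⟩
  by_contra! hlt
  have hnm : n ≤ m := hmax n ⟨v', c', hc', hcl', fun w hw => (hcA' w hw).1⟩
  obtain ⟨a, b, p, ha, hb, hp, hpA, hpX, hpY, hd⟩ := exists_disjoint_paths_of_unseparable
    (X := C) (Y := {w | w ∈ c'.support}) hA hCA (fun w hw => (hcA' w hw).1) (by omega)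
    (by rw [hc'.ncard_support]; omega)
  have hpos := fun i => Walk.exists_getVert_eq_of_mem_support hc.not_nil (ha i)
  choose pos hpos hpos' using hpos
  obtain ⟨i, j, hij, hclose⟩ := exists_close_pair (c := c.length) (t := t) (by omega) ht pos hpos
    (fun i j h => hd i j (a i) (p i).start_mem_support (by
      rw [← hpos' i, h, hpos' j]; exact (p j).start_mem_support))
  have hijne : i ≠ j := fun h => by rw [h] at hij; exact lt_irrefl _ hij
  have harcs := hc.exists_arcs (i := pos i) (k := pos j - pos i)
    (by omega) (by have := hpos j; omega)
  rw [show pos i + (pos j - pos i) = pos j by omega, hpos' i, hpos' j] at harcs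
  obtain ⟨-, q, -, hq, -, hql, -, hqs⟩ := harcs
  have hbne : b i ≠ b j := fun h => hijne (hd i j (b i) (p i).end_mem_support (by
    rw [h]; exact (p j).end_mem_support))
  obtain ⟨r, hr, hrl, hrs⟩ := hc'.exists_long_arc (hb i) (hb j) hbne
  have hCC' : ∀ z ∈ c.support, z ∉ c'.support := fun z hz hz' => (hcA' z hz').2 hz
  have hP := hq.append_of_inter (hp i) fun z hz hz' => hpX i z hz' (hqs hz)
  have hQ := hr.append_of_inter (q := (p j).reverse) (hp j).reverse fun z hz hz' =>
    hpY j z (by simpa using hz') (hrs hz)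
  have hplen : ∀ i, 1 ≤ (p i).length := fun i => by
    rw [Nat.one_le_iff_ne_zero, Ne, Walk.length_eq_zero_iff]
    intro h0
    have h1 : b i ∈ c.support := by
      rw [← h0.eq]; exact ha i
    exact hCC' _ h1 (hb i)
  have hi1 := hplen i
  have hj1 := hplen j
  have hposj := hpos j
  -- The reroute gives up an arc of `C` shorter than `n / 2` and gains an arc of the other cycle of
  -- length at least `n / 2`.
  have hgap : 2 * (pos j - pos i) < n := by
    by_contra! hcon
    have := Nat.mul_le_mul_left t hcon
    have e : t * (2 * (pos j - pos i)) = 2 * ((pos j - pos i) * t) := by ring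
    omega
  have hlen : ((q.append (p i)).append (r.append (p j).reverse)).length =
      q.length + (p i).length + (r.length + (p j).length) := by
    simp only [Walk.length_append, Walk.length_reverse]
  have hcyc : ((q.append (p i)).append (r.append (p j).reverse)).IsCycle := by
    refine hP.isCycle_append_of_inter hQ (fun z hz hz' => ?_) (by
      simp only [Walk.length_append, Walk.length_reverse]; omega)
    rw [Walk.mem_support_append_iff] at hz hz'
    rw [Walk.support_reverse, List.mem_reverse] at hz'
    rcases hz with hz | hz <;> rcases hz' with hz' | hz'
    · exact absurd (hrs hz') (hCC' z (hqs hz))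
    · exact Or.inl (hpX j z hz' (hqs hz))
    · exact Or.inr (hpY i z hz (hrs hz'))
    · exact absurd (hd i j z hz hz') hijne
  have := hmax _ ⟨_, _, hcyc, hlen, fun w hw => by
    simp only [Walk.mem_support_append_iff, Walk.support_reverse, List.mem_reverse] at hw
    rcases hw with (hw | hw) | hw | hw
    exacts [hCA (hqs hw), hpA i w hw, (hcA' w (hrs hw)).1, hpA j w hw]⟩
  omega

end SimpleGraph

/-! ### Growth of `α`-bounded functions -/

/-- Losing a constant factor of the chromatic number costs only a constant factor of `f`. -/
theorem IsAlphaBounded.rpow_mul_le {α : ℝ} {f : ℝ → ℝ} (hf : IsAlphaBounded α f) (hα : 0 ≤ α)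
    {θ k q : ℝ} (hθ : 0 ≤ θ) (hq : 3 ≤ q) (hqk : q ≤ k) (hθq : θ * k ≤ q) :
    θ ^ α * f k ≤ f q := by
  have hk : 0 < k := by linarith
  have h1 := hf.growth q k hq hqk
  have h2 : (θ * k) ^ α ≤ q ^ α := Real.rpow_le_rpow (by positivity) hθq hα
  rw [Real.mul_rpow hθ hk.le] at h2
  have h3 : 0 < k ^ α := Real.rpow_pos_of_pos hk α
  have h4 := mul_le_mul_of_nonneg_right h2 (hf.pos k (by linarith)).le
  refine le_of_mul_le_mul_left ?_ h3
  linarith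

theorem IsAlphaBounded.le_rpow_mul {α M : ℝ} {f : ℝ → ℝ} (hf : IsAlphaBounded α f) (hα : 0 ≤ α)
    (hM : f 3 ≤ M) {k : ℝ} (hk : 3 ≤ k) : f k ≤ k ^ α * M := by
  have h1 := hf.growth 3 k le_rfl hk
  have h2 : (1 : ℝ) ≤ 3 ^ α := Real.one_le_rpow (by norm_num) hα
  have h3 : 0 ≤ k ^ α := Real.rpow_nonneg (by linarith) α
  have h4 := hf.pos k hk
  nlinarith [mul_le_mul_of_nonneg_left hM h3]

/-! ### Cycles of length close to `f k` -/

namespace SimpleGraph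

variable {V : Type u} [Finite V] {G : SimpleGraph V}

/-- If the dominant cycle `C` is too short, then `χ(C) ≤ δ k`, since otherwise `|C| ≥ f(χ(C)) ≥ δ ^
α f k ≥ γ f k`. Hence `H` retains `(1 - δ) k - 2t`, which is at least half of `(1 - δ) k`. -/
theorem exists_long_cycle_or_exists_subset {α m : ℝ} {f : ℝ → ℝ} (hα : 0 < α)
    (hf : IsAlphaBounded α f)
    (hG : ∀ S : Set V, 3 ≤ G.chiOn S → m ≤ G.chiOn S → f (G.chiOn S) ≤ S.ncard)
    {γ δ : ℝ} (hδ : 0 < δ) (hδ1 : δ < 1) (hγ : γ ≤ δ ^ α) {t : ℕ} (ht : 1 ≤ t) {S : Set V}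
    (hk1 : 2 * t + 3 ≤ (1 - δ) / 2 * G.chiOn S) (hk2 : 3 ≤ δ * G.chiOn S)
    (hk3 : m ≤ δ * G.chiOn S) :
    (∃ n : ℕ, γ * f (G.chiOn S) ≤ n ∧ G.HasCycleIn S n) ∨
      ∃ H ⊂ S, (1 - δ) / 2 * G.chiOn S ≤ G.chiOn H ∧ 3 ≤ G.chiOn H ∧
        ∀ n : ℕ, G.HasCycleIn H n → t * n < 2 * (γ * f (G.chiOn S)) := by
  set k := G.chiOn S with hk
  have hkpos : (0 : ℝ) ≤ k := Nat.cast_nonneg k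
  have hk0 : (2 * t + 3 : ℝ) ≤ k := by nlinarith
  obtain ⟨C, H, hCS, hHS, hdisj, hC, hchi, hH⟩ := exists_dominant_cycle G S ht
    (by exact_mod_cast hk0)
  rw [← hk] at hchi
  by_cases hlong : γ * f k ≤ (C.ncard : ℝ)
  · exact Or.inl ⟨_, hlong, hC.mono hCS⟩
  push Not at hlong
  have hk3' : (3 : ℝ) ≤ k := by nlinarith
  have hfk := hf.pos k hk3'
  have hCk : G.chiOn C ≤ k := chiOn_mono hCS
  have hCδ : (G.chiOn C : ℝ) ≤ δ * k := by
    by_contra! hcon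
    have h3 : (3 : ℝ) ≤ G.chiOn C := by linarith
    have h1 := hG C (by exact_mod_cast h3) (by linarith)
    have h2 := hf.rpow_mul_le hα.le hδ.le h3 (by exact_mod_cast hCk) hcon.le
    have h4 := mul_le_mul_of_nonneg_right hγ hfk.le
    linarith
  have hchi' : (k : ℝ) ≤ G.chiOn C + G.chiOn H + 2 * t := by exact_mod_cast hchi
  have hHk : (1 - δ) / 2 * k ≤ G.chiOn H := by linarith
  have hHt : (2 * t + 3 : ℝ) ≤ G.chiOn H := by linarith
  have hHt' : 2 * t + 3 ≤ G.chiOn H := by exact_mod_cast hHt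
  refine Or.inr ⟨H, ⟨hHS, fun hSH => ?_⟩, hHk, by omega, fun n hn => ?_⟩
  · obtain ⟨v, p, -, -, hp⟩ := hC
    have := hp v p.start_mem_support
    exact Set.disjoint_left.1 hdisj this (hSH (hCS this))
  · have : (t * n : ℝ) ≤ 2 * C.ncard := by exact_mod_cast hH (by omega) n hn
    linarith

/-- Induction on `|S|`: with `δ = 1/2` the remainder `H` keeps a quarter of the chromatic number, so
its cycle has length at least `β 4 ^ (-α) f k`, contradicting the bound `2 β f k / t` on the cycles
of `H`. -/
theorem exists_linear_cycle {α : ℝ} (m M : ℝ) (hα : 0 < α) :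
    ∃ β : ℝ, 0 < β ∧ ∀ (V : Type u) [Finite V] (G : SimpleGraph V) (f : ℝ → ℝ),
      IsAlphaBounded α f → f 3 ≤ M →
      (∀ S : Set V, 3 ≤ G.chiOn S → m ≤ G.chiOn S → f (G.chiOn S) ≤ S.ncard) →
      ∀ S : Set V, 3 ≤ G.chiOn S →
        ∃ n : ℕ, β * f (G.chiOn S) ≤ n ∧ G.HasCycleIn S n := by
  obtain ⟨t, ht⟩ := exists_nat_ge (2 * (4 : ℝ) ^ α + 1)
  have h4 : (0 : ℝ) < 4 ^ α := Real.rpow_pos_of_pos (by norm_num) α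
  have ht1 : 1 ≤ t := by
    have : (1 : ℝ) ≤ t := by linarith
    exact_mod_cast this
  obtain ⟨K, hK⟩ := exists_nat_ge (8 * t + 12 + 2 * |m| : ℝ)
  have hKpos : (0 : ℝ) < K := by
    have := abs_nonneg m
    have : (0 : ℝ) ≤ t := Nat.cast_nonneg t
    linarith
  set N : ℝ := (K : ℝ) ^ α * (|M| + 1) with hN
  have hNpos : 0 < N := by positivity
  -- `N` bounds `f` up to the threshold `K`, so with `β ≤ 3 / N` any cycle will do there; `(1 / 2) ^
  -- α` is the largest `γ` allowed for `δ = 1/2`.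
  refine ⟨min ((1 / 2) ^ α) (3 / N), by positivity, fun V _ G f hf hM hG S => ?_⟩
  set β := min ((1 / 2 : ℝ) ^ α) (3 / N) with hβ
  have hβpos : 0 < β := by positivity
  induction hs : S.ncard using Nat.strong_induction_on generalizing S with
  | _ s ih =>
  subst hs
  intro hS
  have hS' : (3 : ℝ) ≤ G.chiOn S := by exact_mod_cast hS
  have hfS := hf.pos _ hS'
  by_cases hSK : (G.chiOn S : ℝ) ≤ K
  · obtain ⟨n, hn, hcyc⟩ := exists_cycle_of_chiOn hS
    refine ⟨n, ?_, hcyc⟩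
    have h1 := hf.le_rpow_mul hα.le hM hS'
    have h2 : (G.chiOn S : ℝ) ^ α ≤ (K : ℝ) ^ α := Real.rpow_le_rpow (by positivity) hSK hα.le
    have h3 : f (G.chiOn S) ≤ N := by
      refine h1.trans (mul_le_mul h2 ?_ ?_ (by positivity))
      · linarith [le_abs_self M]
      · exact (hf.pos 3 le_rfl).le.trans hM
    calc β * f (G.chiOn S) ≤ 3 / N * N := mul_le_mul (min_le_right _ _) h3 hfS.le (by positivity)
      _ = 3 := by field_simp
      _ ≤ n := by exact_mod_cast hS.trans hn
  push Not at hSK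
  have hm := le_abs_self m
  have hm0 := abs_nonneg m
  have ht0 : (0 : ℝ) ≤ t := Nat.cast_nonneg t
  rcases exists_long_cycle_or_exists_subset hα hf hG (γ := β) (δ := 1 / 2) (by norm_num)
    (by norm_num) (min_le_left _ _) ht1 (S := S) (by linarith) (by linarith) (by linarith) with
    h | ⟨H, hHS, hH, hH3, hHn⟩
  · exact h
  obtain ⟨n, hn, hcyc⟩ := ih _ (Set.ncard_lt_ncard hHS (Set.toFinite _)) H rfl hH3
  have h1 := hHn n hcyc
  have hH3' : (3 : ℝ) ≤ G.chiOn H := by exact_mod_cast hH3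
  have h2 := hf.rpow_mul_le hα.le (θ := 1 / 4) (by norm_num) hH3'
    (k := G.chiOn S) (by exact_mod_cast chiOn_mono hHS.1) (by linarith)
  have h3 : (2 : ℝ) ≤ t * (1 / 4) ^ α := by
    rw [one_div, Real.inv_rpow (by norm_num), ← div_eq_mul_inv, le_div_iff₀ h4]
    linarith
  exfalso
  have h5 : t * (β * ((1 / 4) ^ α * f (G.chiOn S))) ≤ t * n :=
    mul_le_mul_of_nonneg_left ((mul_le_mul_of_nonneg_left h2 hβpos.le).trans hn) ht0
  have h6 : 2 * (β * f (G.chiOn S)) ≤ t * (1 / 4) ^ α * (β * f (G.chiOn S)) :=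
    mul_le_mul_of_nonneg_right h3 (by positivity)
  linarith

theorem exists_long_cycle {ε α : ℝ} (m M : ℝ) (hε : 0 < ε) (hα : 0 < α) :
    ∃ K : ℕ, ∀ (V : Type u) [Finite V] (G : SimpleGraph V) (f : ℝ → ℝ),
      IsAlphaBounded α f → f 3 ≤ M →
      (∀ S : Set V, 3 ≤ G.chiOn S → m ≤ G.chiOn S → f (G.chiOn S) ≤ S.ncard) →
      ∀ S : Set V, K ≤ G.chiOn S →
        ∃ n : ℕ, (1 - ε) * f (G.chiOn S) ≤ n ∧ G.HasCycleIn S n := by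
  obtain ⟨β, hβ, hcyc⟩ := exists_linear_cycle.{u} m M hα
  set η := min ε (1 / 2) with hη
  have hη0 : 0 < η := by positivity
  have hη1 : η ≤ 1 / 2 := min_le_right _ _
  have hηε : η ≤ ε := min_le_left _ _
  -- Chosen so that `δ ^ α = 1 - η`; capping `η` at `1/2` keeps the base positive when `ε` is large.
  set δ := (1 - η) ^ (1 / α) with hδ
  have hδ0 : 0 < δ := Real.rpow_pos_of_pos (by linarith) _
  have hδ1 : δ < 1 := Real.rpow_lt_one (by linarith) (by linarith) (by positivity)
  have hδα : δ ^ α = 1 - η := by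
    rw [hδ, ← Real.rpow_mul (by linarith), one_div_mul_cancel hα.ne', Real.rpow_one]
  set θ := (1 - δ) / 2 with hθ
  have hθ0 : 0 < θ := by rw [hθ]; linarith
  have hθα : 0 < θ ^ α := Real.rpow_pos_of_pos hθ0 α
  obtain ⟨t, ht⟩ := exists_nat_ge (2 / (β * θ ^ α) + 1)
  have ht1 : 1 ≤ t := by
    have h0 : 0 < 2 / (β * θ ^ α) := by positivity
    have : (1 : ℝ) ≤ t := by linarith
    exact_mod_cast this
  have ht2 : 2 ≤ t * (β * θ ^ α) := by
    rw [← div_le_iff₀ (by positivity)]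
    linarith
  obtain ⟨K, hK⟩ := exists_nat_ge ((2 * t + 3) / θ + (3 + |m|) / δ)
  refine ⟨K, fun V _ G f hf hM hG S hS => ?_⟩
  have hSK : (K : ℝ) ≤ G.chiOn S := by exact_mod_cast hS
  have hm0 := abs_nonneg m
  have hm := le_abs_self m
  have hp1 : 0 < (2 * t + 3) / θ := by positivity
  have hp2 : 0 < (3 + |m|) / δ := by positivity
  have hk1 : 2 * t + 3 ≤ θ * G.chiOn S := by
    rw [← div_le_iff₀' hθ0]; linarith
  have hk2 : 3 + |m| ≤ δ * G.chiOn S := by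
    rw [← div_le_iff₀' hδ0]; linarith
  have hS3 : (3 : ℝ) ≤ G.chiOn S := by nlinarith [Nat.cast_nonneg (α := ℝ) (G.chiOn S)]
  have hfS := hf.pos _ hS3
  rcases exists_long_cycle_or_exists_subset hα hf hG (γ := 1 - η) hδ0 hδ1 hδα.ge ht1 (S := S)
    hk1 (by linarith) (by linarith) with ⟨n, hn, h⟩ | ⟨H, hHS, hH, hH3, hHn⟩
  · exact ⟨n, (mul_le_mul_of_nonneg_right (by linarith) hfS.le).trans hn, h⟩
  exfalso
  obtain ⟨n, hn, h⟩ := hcyc V G f hf hM hG H hH3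
  have h1 := hHn n h
  have hH3' : (3 : ℝ) ≤ G.chiOn H := by exact_mod_cast hH3
  have h2 := hf.rpow_mul_le hα.le hθ0.le hH3'
    (k := G.chiOn S) (by exact_mod_cast chiOn_mono hHS.1) hH
  have h5 : t * (β * (θ ^ α * f (G.chiOn S))) ≤ t * n :=
    mul_le_mul_of_nonneg_left ((mul_le_mul_of_nonneg_left h2 hβ.le).trans hn) (Nat.cast_nonneg t)
  have h6 := mul_le_mul_of_nonneg_right ht2 hfS.le
  nlinarith

end SimpleGraph

/-! ### Breadth-first levels and cycles of consecutive lengths -/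

namespace SimpleGraph

variable {V : Type u} {G : SimpleGraph V}

theorem exists_parent (G : SimpleGraph V) (r : V) : ∃ par : V → V, ∀ v, G.dist r v ≠ 0 →
    G.Adj v (par v) ∧ G.dist r (par v) + 1 = G.dist r v := by
  have h : ∀ v, ∃ w, G.dist r v ≠ 0 → G.Adj v w ∧ G.dist r w + 1 = G.dist r v := by
    intro v
    by_cases h0 : G.dist r v = 0
    · exact ⟨v, fun h => absurd h0 h⟩
    obtain ⟨p, hp⟩ := (Reachable.of_dist_ne_zero h0).symm.exists_walk_length_eq_dist
    rw [dist_comm] at hp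
    cases p with
    | nil => exact absurd hp.symm h0
    | @cons _ w _ hvw p =>
      refine ⟨w, fun _ => ⟨hvw, ?_⟩⟩
      have h1 := dist_le p
      rw [dist_comm] at h1
      rw [Walk.length_cons] at hp
      obtain ⟨q, hq⟩ := (Reachable.exists_walk_length_eq_dist (G := G) (u := r) (v := w)
        ⟨p.reverse⟩)
      have h2 := dist_le (q.concat hvw.symm)
      rw [Walk.length_concat] at h2
      omega
  choose par hpar using h
  exact ⟨par, hpar⟩

section Ancestors

variable {lvl : V → ℕ} {par : V → V}

theorem level_iterate (hpar : ∀ v, lvl v ≠ 0 → G.Adj v (par v) ∧ lvl (par v) + 1 = lvl v) (v : V)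
    (s : ℕ) (hs : s ≤ lvl v) : lvl (par^[s] v) + s = lvl v := by
  induction s generalizing v with
  | zero => rfl
  | succ s ih =>
    have h := (hpar v (by omega)).2
    have := ih (par v) (by omega)
    rw [Function.iterate_succ_apply]
    omega

theorem exists_ancestor_path
    (hpar : ∀ v, lvl v ≠ 0 → G.Adj v (par v) ∧ lvl (par v) + 1 = lvl v) (v : V) (j : ℕ)
    (hj : j ≤ lvl v) : ∃ q : G.Walk v (par^[j] v), q.IsPath ∧ q.length = j ∧
      ∀ w ∈ q.support, ∃ s ≤ j, w = par^[s] v := by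
  induction j generalizing v with
  | zero => exact ⟨.nil, .nil, rfl, by simp⟩
  | succ j ih =>
    obtain ⟨h1, h2⟩ := hpar v (by omega)
    obtain ⟨q, hq, hql, hqs⟩ := ih (par v) (by omega)
    refine ⟨.cons h1 q, hq.cons fun hv => ?_, by simp [hql], fun w hw => ?_⟩
    · obtain ⟨s, hs, he⟩ := hqs v hv
      have := level_iterate hpar (par v) s (by omega)
      rw [← he] at this
      omega
    · rcases List.mem_cons.1 hw with rfl | hw
      · exact ⟨0, by omega, rfl⟩
      · obtain ⟨s, hs, rfl⟩ := hqs w hw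
        exact ⟨s + 1, by omega, rfl⟩

/-- A path inside one level closes up to a cycle through the lowest common ancestor of its ends. -/
theorem hasCycleOfLength_of_path_in_level
    (hpar : ∀ v, lvl v ≠ 0 → G.Adj v (par v) ∧ lvl (par v) + 1 = lvl v) {a b : V} {i j : ℕ}
    (hj : 0 < j) (hji : j ≤ i) (hjoin : par^[j] a = par^[j] b)
    (hne : ∀ s < j, par^[s] a ≠ par^[s] b) {p : G.Walk a b} (hp : p.IsPath)
    (hlvl : ∀ v ∈ p.support, lvl v = i) : HasCycleOfLength G (p.length + 2 * j) := by
  have ha := hlvl a p.start_mem_support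
  have hb := hlvl b p.end_mem_support
  obtain ⟨qa, hqa, hqal, hqas⟩ := exists_ancestor_path hpar a j (by omega)
  have hb' := exists_ancestor_path hpar b j (by omega)
  rw [← hjoin] at hb'
  obtain ⟨qb, hqb, hqbl, hqbs⟩ := hb'
  have hpl : p.length ≠ 0 := fun h => hne 0 hj (Walk.eq_of_length_eq_zero h)
  have hQ : (qb.append qa.reverse).IsPath := by
    refine hqb.append_of_inter hqa.reverse fun z hz hz' => ?_
    rw [Walk.support_reverse, List.mem_reverse] at hz'
    obtain ⟨s, hs, rfl⟩ := hqbs z hz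
    obtain ⟨s', hs', he⟩ := hqas _ hz'
    have h1 := level_iterate hpar b s (by omega)
    have h2 := level_iterate hpar a s' (by omega)
    rw [he] at h1
    have : s' = s := by omega
    subst this
    rcases hs'.lt_or_eq with h | rfl
    · exact absurd he.symm (hne _ h)
    · exact he
  have hlen : (p.append (qb.append qa.reverse)).length = p.length + 2 * j := by
    simp only [Walk.length_append, Walk.length_reverse]
    omega
  refine ⟨a, p.append (qb.append qa.reverse), hp.isCycle_append_of_inter hQ (fun z hz hz' => ?_)
    (by simp only [Walk.length_append, Walk.length_reverse]; omega), hlen⟩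
  have hz0 := hlvl z hz
  simp only [Walk.mem_support_append_iff, Walk.support_reverse, List.mem_reverse] at hz'
  rcases hz' with hz' | hz'
  · obtain ⟨s, hs, rfl⟩ := hqbs z hz'
    have h1 := level_iterate hpar b s (by omega)
    have : s = 0 := by omega
    subst this
    exact Or.inr rfl
  · obtain ⟨s, hs, rfl⟩ := hqas z hz'
    have h1 := level_iterate hpar a s (by omega)
    have : s = 0 := by omega
    subst this
    exact Or.inl rfl

end Ancestors

/-- Take a path `q` in `H` from the cycle to `B` meeting the cycle only at its start. Preceding it
by `d` steps along the cycle, for each `d < c`, gives the lengths `|q| + d`. -/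
theorem exists_paths_of_consecutive_lengths {H A B : Set V}
    (hconn : ∀ u ∈ H, ∀ v ∈ H, ∃ p : G.Walk u v, ∀ w ∈ p.support, w ∈ H)
    (hAH : A ⊆ H) (hBH : B ⊆ H) (hB : B.Nonempty) {c : ℕ}
    (hc : G.HasCycleIn A c) :
    ∃ l, ∀ d < c, ∃ a ∈ A, ∃ b ∈ B, ∃ p : G.Walk a b, p.IsPath ∧ p.length = l + d ∧
      ∀ w ∈ p.support, w ∈ H := by
  classical
  obtain ⟨v, C, hC, rfl, hCA⟩ := hc
  obtain ⟨b₀, hb₀⟩ := hB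
  obtain ⟨p₀, hp₀⟩ := hconn v (hAH (hCA v C.start_mem_support)) b₀ (hBH hb₀)
  obtain ⟨x, hx, b, hb, q, hq, hqs, hqX, -⟩ := p₀.exists_path_between_sets
    (X := {w | w ∈ C.support}) (Y := B) C.start_mem_support hb₀
  refine ⟨q.length, fun d hd => ?_⟩
  have hR : (C.rotate x hx).IsCycle := hC.rotate hx
  have hRd : d < (C.rotate x hx).length := by rwa [Walk.length_rotate]
  have hP : ((C.rotate x hx).take d).IsPath := hR.isPath_take hRd
  have hPs : ∀ w ∈ ((C.rotate x hx).take d).support, w ∈ C.support := fun w hw =>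
    (Walk.mem_support_rotate_iff C x hx).1 (((C.rotate x hx).isSubwalk_take d).support_subset hw)
  refine ⟨_, hCA _ (hPs _ (Walk.end_mem_support _)), b, hb,
    ((C.rotate x hx).take d).reverse.append q, ?_, ?_, fun w hw => ?_⟩
  · refine hP.reverse.append_of_inter hq fun z hz hz' => hqX z hz' (hPs z ?_)
    simpa using hz
  · rw [Walk.length_append, Walk.length_reverse, Walk.take_length]
    omega
  · rw [Walk.mem_support_append_iff, Walk.support_reverse, List.mem_reverse] at hw
    rcases hw with hw | hw
    exacts [hAH (hCA w (hPs w hw)), hp₀ w (hqs hw)]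

theorem HasCycleIn.hasCycleOfLength {S : Set V} {n : ℕ} (h : G.HasCycleIn S n) :
    HasCycleOfLength G n :=
  let ⟨v, p, hp, hn, _⟩ := h
  ⟨v, p, hp, hn⟩

variable [Finite V]

/-- A critical set is connected: otherwise a component and its complement in the set could be
coloured separately with fewer colours. -/
theorem exists_connected_subset (G : SimpleGraph V) (S : Set V) : ∃ T ⊆ S, G.chiOn T = G.chiOn S ∧
    ∀ u ∈ T, ∀ v ∈ T, ∃ p : G.Walk u v, ∀ w ∈ p.support, w ∈ T := by
  classical
  obtain ⟨T, hTS, hT, hcrit⟩ := exists_critical G S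
  refine ⟨T, hTS, hT, fun u hu v hv => ?_⟩
  by_contra! hcon
  set R : Set V := {z | ∃ p : G.Walk u z, ∀ w ∈ p.support, w ∈ T} with hR
  have hRT : R ⊆ T := fun z ⟨p, hp⟩ => hp z p.end_mem_support
  have huR : u ∈ R := ⟨.nil, by simpa using hu⟩
  have hvR : v ∉ R := fun ⟨p, hp⟩ => by
    obtain ⟨w, hw, hw'⟩ := hcon p
    exact hw' (hp w hw)
  have hcl : ∀ y ∈ R, ∀ z ∈ T, G.Adj y z → z ∈ R := by
    rintro y ⟨p, hp⟩ z hz hyz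
    refine ⟨p.concat hyz, fun w hw => ?_⟩
    rw [Walk.support_concat, List.mem_append, List.mem_singleton] at hw
    rcases hw with hw | rfl
    exacts [hp w hw, hz]
  have h1 := hcrit R ⟨hRT, fun h => hvR (h hv)⟩
  have h2 := hcrit (T \ R) ⟨Set.sdiff_subset, fun h => (h hu).2 huR⟩
  obtain ⟨c, hc, hc'⟩ := isColorableOn_chiOn G R
  obtain ⟨d, hd, hd'⟩ := isColorableOn_chiOn G (T \ R)
  have : G.chiOn T ≤ G.chiOn S - 1 := by
    refine chiOn_le_iff.2 ⟨fun z => if z ∈ R then c z else d z, fun z hz => ?_,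
      fun y hy z hz hyz => ?_⟩
    · dsimp only
      split_ifs with h
      · have := hc z h
        omega
      · have := hd z ⟨hz, h⟩
        omega
    · dsimp only
      split_ifs with h h' h'
      · exact hc' y h z h' hyz
      · exact absurd (hcl y h z hz hyz) h'
      · exact absurd (hcl z h' y hy hyz.symm) h
      · exact hd' y ⟨hy, h⟩ z ⟨hz, h'⟩ hyz
  omega

/-- Edges join vertices of the same or consecutive levels, so two palettes used alternately by
parity colour all of `T`. -/
theorem exists_level_chiOn {T : Set V} (lvl : V → ℕ)
    (hlvl : ∀ u ∈ T, ∀ v ∈ T, G.Adj u v → lvl v ≤ lvl u + 1) :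
    ∃ i, G.chiOn T ≤ 2 * G.chiOn {v ∈ T | lvl v = i} := by
  by_contra! hcon
  set q := (G.chiOn T - 1) / 2 with hq
  have hL : ∀ i, G.IsColorableOn {v ∈ T | lvl v = i} q := fun i =>
    chiOn_le_iff.1 (by have := hcon i; omega)
  choose c hc hc' using hL
  have h0 := hcon 0
  have : G.chiOn T ≤ 2 * q := by
    refine chiOn_le_iff.2 ⟨fun v => c (lvl v) v + q * (lvl v % 2), fun v hv => ?_,
      fun u hu v hv huv => ?_⟩
    · have := hc (lvl v) v ⟨hv, rfl⟩
      rcases Nat.mod_two_eq_zero_or_one (lvl v) with h | h <;> simp only [h] <;> omega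
    · have h1 := hc (lvl u) u ⟨hu, rfl⟩
      have h2 := hc (lvl v) v ⟨hv, rfl⟩
      have h3 := hlvl u hu v hv huv
      have h4 := hlvl v hv u hu huv.symm
      by_cases he : lvl u = lvl v
      · have := hc' (lvl u) u ⟨hu, rfl⟩ v ⟨hv, he.symm⟩ huv
        dsimp only
        rw [← he]
        omega
      · rcases Nat.mod_two_eq_zero_or_one (lvl u) with h | h <;>
          rcases Nat.mod_two_eq_zero_or_one (lvl v) with h' | h' <;> simp only [h, h'] <;> omega
  omega

/-- Some vertex set carries a quarter of the chromatic number, and every cycle in it of length `c`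
yields cycles of `c` consecutive lengths. -/
theorem exists_subset_consecutive_cycles (G : SimpleGraph V) (hG : 3 ≤ G.chiOn Set.univ) :
    ∃ A : Set V, G.chiOn Set.univ ≤ 4 * G.chiOn A ∧
      ∀ c, G.HasCycleIn A c → ∃ a, ∀ d < c, HasCycleOfLength G (a + d) := by
  classical
  obtain ⟨T, -, hT, hconn⟩ := exists_connected_subset G Set.univ
  obtain ⟨r, hr⟩ : T.Nonempty := by
    rw [Set.nonempty_iff_ne_empty]
    rintro rfl
    rw [chiOn_empty] at hT
    omega
  have hreach : ∀ v ∈ T, G.Reachable r v := fun v hv =>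
    let ⟨p, _⟩ := hconn r hr v hv
    ⟨p⟩
  obtain ⟨par, hpar⟩ := exists_parent G r
  obtain ⟨i, hi⟩ := exists_level_chiOn (G := G) (T := T) (G.dist r) fun u hu v hv huv => by
    obtain ⟨p, hp⟩ := (hreach u hu).exists_walk_length_eq_dist
    have := dist_le (p.concat huv)
    rwa [Walk.length_concat, hp] at this
  obtain ⟨H, hHL, hH, hHconn⟩ := exists_connected_subset G {v ∈ T | G.dist r v = i}
  have hanc : ∃ j, j ≤ i ∧ ∀ u ∈ H, ∀ v ∈ H, par^[j] u = par^[j] v := by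
    have hroot : ∀ u ∈ H, par^[i] u = r := fun u hu => by
      have h1 := (hHL hu).2
      have h2 := level_iterate hpar u i h1.ge
      obtain ⟨q, -⟩ := exists_ancestor_path hpar u i h1.ge
      have h3 : G.Reachable r (par^[i] u) := (hreach u (hHL hu).1).trans ⟨q⟩
      exact (h3.dist_eq_zero_iff.1 (by omega)).symm
    exact ⟨i, le_rfl, fun u hu v hv => by rw [hroot u hu, hroot v hv]⟩
  -- With `j` least such that all of `H` shares its `j`-th ancestor, splitting `H` by the ancestor
  -- at height `j - 1` is nontrivial, and any two vertices on opposite sides first meet exactly `j`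
  -- steps up. Every path across thus gains the same `2j`.
  obtain ⟨hji, hjoin⟩ := Nat.find_spec hanc
  set j := Nat.find hanc with hj
  have hj0 : 0 < j := by
    by_contra! h0
    have h0 : j = 0 := by omega
    rw [h0] at hjoin
    have : G.chiOn H ≤ 1 := chiOn_le_iff.2 ⟨fun _ => 0, by simp, fun u hu v hv huv =>
      absurd (hjoin u hu v hv) huv.ne⟩
    omega
  obtain ⟨x, hx, y, hy, hxy⟩ : ∃ x ∈ H, ∃ y ∈ H, par^[j - 1] x ≠ par^[j - 1] y := by
    by_contra! hcon
    exact Nat.find_min hanc (m := j - 1) (by omega) ⟨by omega, hcon⟩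
  have main : ∀ A B : Set V, A ⊆ H → B ⊆ H → B.Nonempty →
      (∀ a ∈ A, ∀ b ∈ B, par^[j - 1] a ≠ par^[j - 1] b) →
      ∀ c, G.HasCycleIn A c → ∃ a, ∀ d < c, HasCycleOfLength G (a + d) := by
    intro A B hA hB hBne hAB c hc
    obtain ⟨l, hl⟩ := exists_paths_of_consecutive_lengths hHconn hA hB hBne hc
    refine ⟨l + 2 * j, fun d hd => ?_⟩
    obtain ⟨a, ha, b, hb, p, hp, hpl, hpH⟩ := hl d hd
    have := hasCycleOfLength_of_path_in_level hpar hj0 hji (hjoin a (hA ha) b (hB hb))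
      (fun s hs he => hAB a ha b hb (by
        rw [show j - 1 = (j - 1 - s) + s by omega, Function.iterate_add_apply,
          Function.iterate_add_apply, he])) hp (fun v hv => (hHL (hpH v hv)).2)
    rwa [show p.length + 2 * j = l + 2 * j + d by omega] at this
  set A : Set V := {v ∈ H | par^[j - 1] v = par^[j - 1] x} with hA
  set B : Set V := {v ∈ H | par^[j - 1] v ≠ par^[j - 1] x} with hB
  have hAB : H = A ∪ B := by
    ext v
    simp only [hA, hB, Set.mem_union, Set.mem_ofPred_eq]
    tauto
  have hunion := chiOn_union_le G A B
  rw [← hAB] at hunion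
  have hsep : ∀ a ∈ A, ∀ b ∈ B, par^[j - 1] a ≠ par^[j - 1] b := fun a ha b hb h =>
    hb.2 (h.symm.trans ha.2)
  rcases le_total (G.chiOn B) (G.chiOn A) with h | h
  · exact ⟨A, by omega, main A B (fun v hv => hv.1) (fun v hv => hv.1) ⟨y, hy, hxy.symm⟩ hsep⟩
  · exact ⟨B, by omega, main B A (fun v hv => hv.1) (fun v hv => hv.1) ⟨x, hx, rfl⟩
      fun b hb a ha h => hsep a ha b hb h.symm⟩

/-! ### From the graph property to vertex sets, and conclusion -/

theorem chiOn_univ {k : ℕ} (h : G.chromaticNumber = k) : G.chiOn Set.univ = k := by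
  have h1 := chromaticNumber_induce G Set.univ
  have h2 : (G.induce Set.univ).chromaticNumber = G.chromaticNumber := by
    refine le_antisymm ?_ ?_
    · exact chromaticNumber_mono_of_hom (induceUnivIso G).toHom
    · exact chromaticNumber_mono_of_hom (induceUnivIso G).symm.toHom
  rw [h2, h] at h1
  exact_mod_cast h1.symm

theorem le_ncard_of_le_minOrder {P : GraphProperty.{u}} (hP : P.IsMonotone) {f : ℝ → ℝ} {m : ℝ}
    (hf : ∀ k : ℕ, 3 ≤ k → m ≤ (k : ℝ) →
      ENNReal.ofReal (f (k : ℝ)) ≤ ((P.minOrder k : ℕ∞) : ℝ≥0∞)) (hG : P V G) (S : Set V)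
    (h3 : 3 ≤ G.chiOn S) (hm : m ≤ G.chiOn S) : f (G.chiOn S) ≤ S.ncard := by
  have h1 : P.minOrder (G.chiOn S) ≤ (S.ncard : ℕ∞) := by
    refine sInf_le ⟨S, inferInstance, G.induce S, ?_, chromaticNumber_induce G S, ?_⟩
    · exact hP V S G (G.induce S) ⟨(Embedding.induce S).toCopy⟩ hG
    · rw [ENat.card_eq_coe_natCard, Nat.card_coe_set_eq]
  have h2 := (hf _ h3 hm).trans (ENat.toENNReal_mono h1)
  rw [ENat.toENNReal_coe] at h2
  exact (ENNReal.ofReal_le_natCast).1 h2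

end SimpleGraph

open SimpleGraph

theorem theorem2 (ε α m M : ℝ) (hε : 0 < ε) (hα : 1 ≤ α) (hm : 1 ≤ m) :
    ∃ k₁ : ℕ, ∀ (f : ℝ → ℝ) (P : GraphProperty.{u}),
      IsAlphaBounded α f → f 3 ≤ M → P.IsMonotone →
      (∀ k : ℕ, 3 ≤ k → m ≤ (k : ℝ) →
        ENNReal.ofReal (f (k : ℝ)) ≤ ((P.minOrder k : ℕ∞) : ℝ≥0∞)) →
      ∀ k : ℕ, k₁ ≤ k →
        ∀ (V : Type u) [Finite V] (G : SimpleGraph V), P V G → G.chromaticNumber = (k : ℕ∞) →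
          (∃ n : ℕ, (1 - ε) * f (k : ℝ) ≤ (n : ℝ) ∧ HasCycleOfLength G n) ∧
          (∃ a t : ℕ, (1 - ε) * f ((k : ℝ) / 4) ≤ (t : ℝ) ∧
            ∀ i : ℕ, i < t → HasCycleOfLength G (a + i)) := by
  obtain ⟨K, hK⟩ := exists_long_cycle.{u} m M hε (by linarith : 0 < α)
  -- This makes a quarter of `k` at least `K`, for the long cycle inside `A`, and at least `3`, the
  -- start of the domain of `f`.
  refine ⟨4 * K + 12, fun f P hf hM hP hfP k hk V _ G hG hGk => ?_⟩
  have hcard := le_ncard_of_le_minOrder hP hfP hG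
  have huniv := chiOn_univ hGk
  constructor
  · obtain ⟨n, hn, h⟩ := hK V G f hf hM hcard Set.univ (by omega)
    rw [huniv] at hn
    exact ⟨n, hn, h.hasCycleOfLength⟩
  · obtain ⟨A, hA, hcons⟩ := exists_subset_consecutive_cycles G (by omega)
    rw [huniv] at hA
    obtain ⟨n, hn, h⟩ := hK V G f hf hM hcard A (by omega)
    obtain ⟨a, ha⟩ := hcons n h
    refine ⟨a, n, ?_, ha⟩
    have hk12 : (12 : ℝ) ≤ k := by exact_mod_cast (by omega : 12 ≤ k)
    have hA' : (k : ℝ) ≤ 4 * G.chiOn A := by exact_mod_cast hA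
    have h3 : (3 : ℝ) ≤ k / 4 := by linarith
    -- Monotonicity of `f` survives multiplication by `1 - ε` only if `ε ≤ 1`; otherwise the bound
    -- is nonpositive.
    rcases le_total ε 1 with h1 | h1
    · refine (mul_le_mul_of_nonneg_left ?_ (by linarith)).trans hn
      exact hf.mono h3 (show (3 : ℝ) ≤ G.chiOn A by linarith) (by linarith)
    · exact (mul_nonpos_of_nonpos_of_nonneg (by linarith) (hf.pos _ h3).le).trans
        (Nat.cast_nonneg n)
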